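/- Let $n>1$, let $(M',g',I',J',K')$ be a hyper-Kähler manifold of dimension $4(n-1)$ (that is, $g'$ is a Riemannian metric, $I'^2=J'^2=K'^2=-1=I'J'K'$, and $I',J',K'$ are $g'$-orthogonal and parallel for the Levi-Civita connection of $g'$), and let $\alpha_{I'},\alpha_{J'},\alpha_{K'}$ be smooth 1-forms on $M'$ with $d\alpha_{I'}=\Omega_{I'}$, $d\alpha_{J'}=\Omega_{J'}$, $d\alpha_{K'}=\Omega_{K'}$, where $\Omega_{A}(X,Y)=g'(AX,Y)$. (Such forms always exist locally on $M'$.) Let $\nu<0$ be a constant, let $M=\{q=t+ui+vj+wk\in\mathbb H: t>0\}\times M'$ and let $\pi:M\to M'$ be the projection. An endomorphism $A$ of the tangent bundle acts on 1-forms by $A\psi=-\psi\circ A$. Let $(I,J,K)$ be the almost hypercomplex structure on $M$ given by $$I\,dt=-du+\nu\pi^*\alpha_{I'},\qquad J\,dt=-dv+\nu\pi^*\alpha_{J'},\qquad K\,dt=-dw+\nu\pi^*\alpha_{K'},$$ $$I\pi^*\beta=\pi^*I'\beta,\qquad J\pi^*\beta=\pi^*J'\beta,\qquad K\pi^*\beta=\pi^*K'\beta\qquad(\beta\in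 T^*M'),$$ and let $$g=-\frac1{\nu t^2}\bigl(dt\otimes dt+I\,dt\otimes I\,dt+J\,dt\otimes J\,dt+K\,dt\otimes K\,dt\bigr)+\frac1t\,\pi^*g'.$$ Then $(M,g,I,J,K)$ is a hyper-Hermitian quaternionic Kähler manifold of dimension $4n$: $g$ is a Riemannian metric, $I,J,K$ are $g$-orthogonal and integrable with $I^2=J^2=K^2=-1=IJK$, the bundle $\mathrm{span}\{I,J,K\}$ is parallel for the Levi-Civita connection $\nabla$ of $g$, and the scalar curvature $s$ of $g$ is non-zero. Its reduced scalar curvature $\frac{s}{4n(n+2)}$ is equal to $\nu$. Its Lee form, that is, the common Lee form $\varphi(X)=\frac12\operatorname{trace}\{Y\mapsto A(\nabla_Y A)X\}$ of $A=I,J,K$, is $\varphi=-d\ln t$, and it satisfies $|\varphi|^2+\nu=0$. -/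

import Mathlib

set_option maxSynthPendingDepth 3

open scoped Manifold ContDiff Quaternion

noncomputable section

namespace HHqK

/-! ### Riemannian geometry in a coordinate domain

`F` is the coordinate space; tensor fields are functions on `F` with values in the space of
tensors, and everything is evaluated at points of open sets where they are smooth. -/

section Coordinates

variable {F : Type*} [NormedAddCommGroup F] [NormedSpace ℝ F]

/-- Christoffel symbols of the first kind:
`christoffelLower g y X Y Z = (1/2) (∂_X g(Y,Z) + ∂_Y g(X,Z) - ∂_Z g(X,Y))`. -/
def christoffelLower (g : F → F →L[ℝ] F →L[ℝ] ℝ) (y : F) : F →L[ℝ] F →L[ℝ] F →L[ℝ] ℝ :=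
  let T : F →L[ℝ] F →L[ℝ] F →L[ℝ] ℝ := fderiv ℝ g y
  let S : F →L[ℝ] F →L[ℝ] F →L[ℝ] ℝ :=
    ((ContinuousLinearMap.flipₗᵢ ℝ F F ℝ).toContinuousLinearEquiv :
      (F →L[ℝ] F →L[ℝ] ℝ) →L[ℝ] (F →L[ℝ] F →L[ℝ] ℝ)) ∘L T.flip
  (1 / 2 : ℝ) • (T + T.flip - S)

theorem christoffelLower_apply (g : F → F →L[ℝ] F →L[ℝ] ℝ) (y X Y Z : F) :
    christoffelLower g y X Y Z =
      1 / 2 * (fderiv ℝ g y X Y Z + fderiv ℝ g y Y X Z - fderiv ℝ g y Z X Y) := by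
  simp [christoffelLower]

/-- Christoffel symbols `Γ(X,Y)` of the Levi-Civita connection, so that
`∇_X Y = ∂_X Y + Γ(X,Y)`; here `(g y).inverse` is the musical isomorphism `♯` of `g`. -/
def christoffel (g : F → F →L[ℝ] F →L[ℝ] ℝ) (y : F) : F →L[ℝ] F →L[ℝ] F :=
  (ContinuousLinearMap.compL ℝ F (F →L[ℝ] ℝ) F (g y).inverse) ∘L christoffelLower g y

/-- The covariant derivative of a field of endomorphisms:
`(∇_X A) Y = (∂_X A) Y + Γ(X, A Y) - A Γ(X, Y)`. -/
def nablaEnd (g : F → F →L[ℝ] F →L[ℝ] ℝ) (A : F → F →L[ℝ] F) (y : F) : F →L[ℝ] F →L[ℝ] F :=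
  fderiv ℝ A y + ((ContinuousLinearMap.compL ℝ F F F).flip (A y)) ∘L christoffel g y -
    (ContinuousLinearMap.compL ℝ F F F (A y)) ∘L christoffel g y

theorem nablaEnd_apply (g : F → F →L[ℝ] F →L[ℝ] ℝ) (A : F → F →L[ℝ] F) (y X Y : F) :
    nablaEnd g A y X Y =
      fderiv ℝ A y X Y + christoffel g y X (A y Y) - A y (christoffel g y X Y) := by
  simp [nablaEnd]

/-- The curvature tensor `R(X,Y)Z = ∇_X ∇_Y Z - ∇_Y ∇_X Z - ∇_[X,Y] Z`. -/
def curvature (g : F → F →L[ℝ] F →L[ℝ] ℝ) (y : F) : F →L[ℝ] F →L[ℝ] F →L[ℝ] F :=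
  fderiv ℝ (christoffel g) y - (fderiv ℝ (christoffel g) y).flip +
    ((ContinuousLinearMap.compL ℝ F F F).bilinearComp (christoffel g y) (christoffel g y) -
      ((ContinuousLinearMap.compL ℝ F F F).bilinearComp (christoffel g y) (christoffel g y)).flip)

theorem curvature_apply (g : F → F →L[ℝ] F →L[ℝ] ℝ) (y X Y Z : F) :
    curvature g y X Y Z =
      fderiv ℝ (christoffel g) y X Y Z - fderiv ℝ (christoffel g) y Y X Z +
        (christoffel g y X (christoffel g y Y Z) - christoffel g y Y (christoffel g y X Z)) := by
  simp [curvature]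

/-- The Ricci tensor `Ric(Y,Z) = trace (X ↦ R(X,Y)Z)`. -/
def ricci (g : F → F →L[ℝ] F →L[ℝ] ℝ) (y : F) : F →ₗ[ℝ] F →ₗ[ℝ] ℝ :=
  LinearMap.mk₂ ℝ
    (fun Y Z => LinearMap.trace ℝ F (((curvature g y).flip Y).flip Z).toLinearMap)
    (fun _ _ _ => by rw [← map_add]; congr 1; ext; simp)
    (fun _ _ _ => by rw [← map_smul]; congr 1; ext; simp)
    (fun _ _ _ => by rw [← map_add]; congr 1; ext; simp)
    (fun _ _ _ => by rw [← map_smul]; congr 1; ext; simp)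

/-- The scalar curvature: the trace of the Ricci tensor with respect to `g`. -/
def scalarCurvature [FiniteDimensional ℝ F] (g : F → F →L[ℝ] F →L[ℝ] ℝ) (y : F) : ℝ :=
  LinearMap.trace ℝ F ((g y).inverse.toLinearMap ∘ₗ
    (LinearMap.toContinuousLinearMap (𝕜 := ℝ) (E := F) (F' := ℝ)).toLinearMap ∘ₗ ricci g y)

/-- The Lee form of `A` with respect to `g`: `φ(V) = (1/2) trace (X ↦ A ((∇_X A) V))`. -/
def leeForm (g : F → F →L[ℝ] F →L[ℝ] ℝ) (A : F → F →L[ℝ] F) (y V : F) : ℝ :=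
  1 / 2 * LinearMap.trace ℝ F ((A y) ∘L (nablaEnd g A y).flip V).toLinearMap

/-- The Nijenhuis tensor `[AX,AY] - A[AX,Y] - A[X,AY] - [X,Y]` of an almost complex
structure `A`, written for the constant coordinate fields `X`, `Y`. -/
def nijenhuis (A : F → F →L[ℝ] F) (y X Y : F) : F :=
  fderiv ℝ A y (A y X) Y - fderiv ℝ A y (A y Y) X
    + A y (fderiv ℝ A y Y X) - A y (fderiv ℝ A y X Y)

/-- The exterior derivative of a 1-form: `dβ(X,Y) = ∂_X (β Y) - ∂_Y (β X)` for constant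
coordinate fields `X`, `Y`. -/
def extDerivForm (β : F → F →L[ℝ] ℝ) (y X Y : F) : ℝ :=
  fderiv ℝ β y X Y - fderiv ℝ β y Y X

end Coordinates

/-! ### Tensor fields on a manifold

The notions below are for manifolds without boundary, so that the targets of the extended charts
are open subsets of `F`. Differential conditions on tensor fields are expressed through their
coordinate expressions at all points of all charts of the atlas; they are tensorial, hence do not
depend on the choice of the (smoothly compatible) charts. -/

section Manifold

variable {F : Type*} [NormedAddCommGroup F] [NormedSpace ℝ F]
  {H : Type*} [TopologicalSpace H] (𝓜 : ModelWithCorners ℝ F H)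
  (N : Type*) [TopologicalSpace N] [ChartedSpace H N]

/-- Fields of covectors on `N`. -/
abbrev FormField : Type _ := ∀ x : N, TangentSpace 𝓜 x →L[ℝ] ℝ

/-- Fields of endomorphisms of the tangent bundle of `N`. -/
abbrev EndField : Type _ := ∀ x : N, TangentSpace 𝓜 x →L[ℝ] TangentSpace 𝓜 x

/-- Fields of bilinear forms on the tangent bundle of `N`. -/
abbrev BilinField : Type _ := ∀ x : N, TangentSpace 𝓜 x →L[ℝ] TangentSpace 𝓜 x →L[ℝ] ℝ

variable {𝓜 N}

/-- The coordinate expression of a field of covectors in the chart `e`: its pullback by the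
inverse of the chart. -/
def chartForm (e : OpenPartialHomeomorph N H) (β : FormField 𝓜 N) (y : F) : F →L[ℝ] ℝ :=
  (β ((e.extend 𝓜).symm y)) ∘L (mfderiv 𝓘(ℝ, F) 𝓜 (e.extend 𝓜).symm y)

/-- The coordinate expression of a field of endomorphisms in the chart `e`. -/
def chartEnd (e : OpenPartialHomeomorph N H) (A : EndField 𝓜 N) (y : F) : F →L[ℝ] F :=
  (mfderiv 𝓜 𝓘(ℝ, F) (e.extend 𝓜) ((e.extend 𝓜).symm y)) ∘L
    (A ((e.extend 𝓜).symm y)) ∘L (mfderiv 𝓘(ℝ, F) 𝓜 (e.extend 𝓜).symm y)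

/-- The coordinate expression of a field of bilinear forms in the chart `e`. -/
def chartBilin (e : OpenPartialHomeomorph N H) (g : BilinField 𝓜 N) (y : F) :
    F →L[ℝ] F →L[ℝ] ℝ :=
  let b : F →L[ℝ] F →L[ℝ] ℝ := g ((e.extend 𝓜).symm y)
  let D : F →L[ℝ] F := mfderiv 𝓘(ℝ, F) 𝓜 (e.extend 𝓜).symm y
  b.bilinearComp D D

/-- Smooth 1-forms: the coordinate expressions in the charts of the atlas are smooth. -/
def SmoothForm (β : FormField 𝓜 N) : Prop :=
  ∀ e ∈ atlas H N, ContDiffOn ℝ ∞ (chartForm e β) (e.extend 𝓜).target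

/-- Smooth fields of endomorphisms. -/
def SmoothEnd (A : EndField 𝓜 N) : Prop :=
  ∀ e ∈ atlas H N, ContDiffOn ℝ ∞ (chartEnd e A) (e.extend 𝓜).target

/-- Smooth fields of bilinear forms. -/
def SmoothBilin (g : BilinField 𝓜 N) : Prop :=
  ∀ e ∈ atlas H N, ContDiffOn ℝ ∞ (chartBilin e g) (e.extend 𝓜).target

/-- (Smooth) Riemannian metrics. -/
structure IsRiemannianMetric (g : BilinField 𝓜 N) : Prop where
  smooth : SmoothBilin g
  symm : ∀ (x : N) (X Y : TangentSpace 𝓜 x), g x X Y = g x Y X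
  pos : ∀ (x : N) (X : TangentSpace 𝓜 x), X ≠ 0 → 0 < g x X X

/-- Almost hypercomplex structures: `I² = J² = K² = -1 = IJK`. -/
structure IsAlmostHypercomplex (I J K : EndField 𝓜 N) : Prop where
  smooth_I : SmoothEnd I
  smooth_J : SmoothEnd J
  smooth_K : SmoothEnd K
  I_sq : ∀ (x : N) (X : TangentSpace 𝓜 x), I x (I x X) = -X
  J_sq : ∀ (x : N) (X : TangentSpace 𝓜 x), J x (J x X) = -X
  K_sq : ∀ (x : N) (X : TangentSpace 𝓜 x), K x (K x X) = -X
  IJK : ∀ (x : N) (X : TangentSpace 𝓜 x), I x (J x (K x X)) = -X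

/-- `A` is orthogonal with respect to `g`. -/
def IsOrthogonal (g : BilinField 𝓜 N) (A : EndField 𝓜 N) : Prop :=
  ∀ (x : N) (X Y : TangentSpace 𝓜 x), g x (A x X) (A x Y) = g x X Y

/-- Almost hyper-Hermitian structures. -/
structure IsAlmostHyperHermitian (g : BilinField 𝓜 N) (I J K : EndField 𝓜 N) : Prop where
  metric : IsRiemannianMetric g
  hypercomplex : IsAlmostHypercomplex I J K
  orth_I : IsOrthogonal g I
  orth_J : IsOrthogonal g J
  orth_K : IsOrthogonal g K

/-- `A` is parallel for the Levi-Civita connection of `g`. -/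
def IsParallel (g : BilinField 𝓜 N) (A : EndField 𝓜 N) : Prop :=
  ∀ e ∈ atlas H N, ∀ y ∈ (e.extend 𝓜).target, nablaEnd (chartBilin e g) (chartEnd e A) y = 0

/-- Integrability of an almost complex structure: its Nijenhuis tensor vanishes. -/
def IsIntegrable (A : EndField 𝓜 N) : Prop :=
  ∀ e ∈ atlas H N, ∀ y ∈ (e.extend 𝓜).target, ∀ X Y : F, nijenhuis (chartEnd e A) y X Y = 0

/-- Hyper-Kähler structures. -/
structure IsHyperKahler (g : BilinField 𝓜 N) (I J K : EndField 𝓜 N) : Prop where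
  almostHyperHermitian : IsAlmostHyperHermitian g I J K
  parallel_I : IsParallel g I
  parallel_J : IsParallel g J
  parallel_K : IsParallel g K

/-- The bundle of endomorphisms spanned by the global frame `I`, `J`, `K` is parallel for the
Levi-Civita connection of `g`: all covariant derivatives of the frame lie in the span of the
frame. -/
def SpanParallel (g : BilinField 𝓜 N) (I J K : EndField 𝓜 N) : Prop :=
  ∀ e ∈ atlas H N, ∀ y ∈ (e.extend 𝓜).target, ∀ A ∈ ({I, J, K} : Set (EndField 𝓜 N)), ∀ X : F,
    nablaEnd (chartBilin e g) (chartEnd e A) y X ∈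
      Submodule.span ℝ ({chartEnd e I y, chartEnd e J y, chartEnd e K y} : Set (F →L[ℝ] F))

/-- The scalar curvature of `g` is the function `s`. -/
def HasScalarCurvature [FiniteDimensional ℝ F] (g : BilinField 𝓜 N) (s : N → ℝ) : Prop :=
  ∀ e ∈ atlas H N, ∀ y ∈ (e.extend 𝓜).target,
    scalarCurvature (chartBilin e g) y = s ((e.extend 𝓜).symm y)

/-- The reduced scalar curvature of the `4n`-dimensional quaternionic Kähler metric `g` is the
constant `ν`, that is, the scalar curvature is the constant `s` with `ν = s / (4 n (n + 2))`. -/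
def HasReducedScalarCurvature [FiniteDimensional ℝ F] (n : ℕ) (g : BilinField 𝓜 N) (ν : ℝ) :
    Prop :=
  ∃ s : ℝ, HasScalarCurvature g (fun _ => s) ∧ ν = s / (4 * n * (n + 2))

/-- The Lee form of `A` with respect to `g` is `φ`. -/
def HasLeeForm (g : BilinField 𝓜 N) (A : EndField 𝓜 N) (φ : FormField 𝓜 N) : Prop :=
  ∀ e ∈ atlas H N, ∀ y ∈ (e.extend 𝓜).target, ∀ V : F,
    leeForm (chartBilin e g) (chartEnd e A) y V = chartForm e φ y V

/-- `α` is a primitive of the Kähler form `Ω(X,Y) = g(AX,Y)` of `(g,A)`: `dα = Ω`. -/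
def IsPrimitiveOfKahlerForm (g : BilinField 𝓜 N) (A : EndField 𝓜 N) (α : FormField 𝓜 N) :
    Prop :=
  ∀ e ∈ atlas H N, ∀ y ∈ (e.extend 𝓜).target, ∀ X Y : F,
    extDerivForm (chartForm e α) y X Y = chartBilin e g y (chartEnd e A y X) Y

/-- `(g,I,J,K)` is a hyper-Hermitian quaternionic Kähler structure on the manifold `N` of
dimension `4n`, `n > 1`: `I`, `J`, `K` are integrable, and the bundle that they span is a
quaternionic Kähler structure with non-zero scalar curvature. -/
structure IsHyperHermitianQuaternionicKahler [FiniteDimensional ℝ F] (n : ℕ)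
    (g : BilinField 𝓜 N) (I J K : EndField 𝓜 N) : Prop where
  one_lt : 1 < n
  dim : Module.finrank ℝ F = 4 * n
  almostHyperHermitian : IsAlmostHyperHermitian g I J K
  integrable_I : IsIntegrable I
  integrable_J : IsIntegrable J
  integrable_K : IsIntegrable K
  parallel : SpanParallel g I J K
  scalarCurvature_ne_zero : ∀ e ∈ atlas H N, ∀ y ∈ (e.extend 𝓜).target,
    scalarCurvature (chartBilin e g) y ≠ 0

/-- The action of an endomorphism field on 1-forms: `Aψ = -ψ ∘ A`. -/
def actForm (A : EndField 𝓜 N) (ψ : FormField 𝓜 N) : FormField 𝓜 N :=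
  fun x => -((ψ x) ∘L (A x))

/-- The square of the norm of a 1-form, `|φ|² = φ(φ♯)`. -/
def normSqForm (g : BilinField 𝓜 N) (φ : FormField 𝓜 N) (x : N) : ℝ :=
  φ x ((g x).inverse (φ x))

end Manifold

/-! ### The construction on `{q ∈ ℍ : t > 0} × M'` -/

section Construction

/-- The open half-space `{q = t + ui + vj + wk ∈ ℍ : t > 0}`. -/
def halfSpace : TopologicalSpace.Opens ℍ[ℝ] :=
  ⟨{q | 0 < q.re}, isOpen_lt continuous_const Quaternion.continuous_re⟩

variable {E : Type*} [NormedAddCommGroup E] [NormedSpace ℝ E]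
  {M' : Type*} [TopologicalSpace M'] [ChartedSpace E M']

variable (E) in
/-- The model of the product manifold `{t > 0} × M'`. -/
abbrev prodModel : ModelWithCorners ℝ (ℍ[ℝ] × E) (ModelProd ℍ[ℝ] E) :=
  𝓘(ℝ, ℍ[ℝ]).prod 𝓘(ℝ, E)

/-- The differential of a real function. -/
def differential (f : halfSpace × M' → ℝ) : FormField (prodModel E) (halfSpace × M') :=
  fun p => mfderiv (prodModel E) 𝓘(ℝ, ℝ) f p

variable (E M') in
/-- The 1-form `dt` on `{t > 0} × M'`. -/
def dt : FormField (prodModel E) (halfSpace × M') := differential fun p => (p.1 : ℍ[ℝ]).re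

variable (E M') in
/-- The 1-form `du` on `{t > 0} × M'`. -/
def du : FormField (prodModel E) (halfSpace × M') := differential fun p => (p.1 : ℍ[ℝ]).imI

variable (E M') in
/-- The 1-form `dv` on `{t > 0} × M'`. -/
def dv : FormField (prodModel E) (halfSpace × M') := differential fun p => (p.1 : ℍ[ℝ]).imJ

variable (E M') in
/-- The 1-form `dw` on `{t > 0} × M'`. -/
def dw : FormField (prodModel E) (halfSpace × M') := differential fun p => (p.1 : ℍ[ℝ]).imK

/-- The pullback of a 1-form by the projection `π : {t > 0} × M' → M'`. -/
def pullForm (β : FormField 𝓘(ℝ, E) M') : FormField (prodModel E) (halfSpace × M') :=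
  fun p => (β p.2) ∘L (mfderiv (prodModel E) 𝓘(ℝ, E) Prod.snd p)

/-- The pullback of a bilinear form by the projection `π : {t > 0} × M' → M'`. -/
def pullBilin (g : BilinField 𝓘(ℝ, E) M') : BilinField (prodModel E) (halfSpace × M') :=
  fun p =>
    let b : E →L[ℝ] E →L[ℝ] ℝ := g p.2
    let D : ℍ[ℝ] × E →L[ℝ] E := mfderiv (prodModel E) 𝓘(ℝ, E) Prod.snd p
    b.bilinearComp D D

/-- The quaternion `i`. -/
def quatI : ℍ[ℝ] := ⟨0, 1, 0, 0⟩

/-- The quaternion `j`. -/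
def quatJ : ℍ[ℝ] := ⟨0, 0, 1, 0⟩

/-- The quaternion `k`. -/
def quatK : ℍ[ℝ] := ⟨0, 0, 0, 1⟩

/-- The quaternion valued 1-form `ν (α_I i + α_J j + α_K k)` on `M'`. -/
def connForm (ν : ℝ) (αI αJ αK : FormField 𝓘(ℝ, E) M') (x : M') :
    TangentSpace 𝓘(ℝ, E) x →L[ℝ] ℍ[ℝ] :=
  ν • ((αI x).smulRight quatI + (αJ x).smulRight quatJ +
    (αK x).smulRight quatK)

/-- The lift to `{t > 0} × M'` of an endomorphism field `A'` of `M'`, with the imaginary unit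
`a` acting on the fibres. In terms of the quaternion valued 1-form
`Θ = dq - π^* η`, where `η = ν (α_I i + α_J j + α_K k)`, it is the endomorphism field `A` with
`Θ (A X) = -Θ(X) a` and `π_* (A X) = A' (π_* X)`. A tangent vector `X` of the product is the
pair of its components in `ℍ` and in `M'`. -/
def liftEnd (η : ∀ x : M', TangentSpace 𝓘(ℝ, E) x →L[ℝ] ℍ[ℝ]) (a : ℍ[ℝ])
    (A' : EndField 𝓘(ℝ, E) M') : EndField (prodModel E) (halfSpace × M') :=
  fun p =>
    let η' : E →L[ℝ] ℍ[ℝ] := η p.2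
    let B' : E →L[ℝ] E := A' p.2
    let Θ : ℍ[ℝ] × E →L[ℝ] ℍ[ℝ] :=
      ContinuousLinearMap.fst ℝ ℍ[ℝ] E - η' ∘L ContinuousLinearMap.snd ℝ ℍ[ℝ] E
    ((η' ∘L B' ∘L ContinuousLinearMap.snd ℝ ℍ[ℝ] E -
        (ContinuousLinearMap.mul ℝ ℍ[ℝ]).flip a ∘L Θ).prod
      (B' ∘L ContinuousLinearMap.snd ℝ ℍ[ℝ] E) : ℍ[ℝ] × E →L[ℝ] ℍ[ℝ] × E)

/-- The structure `I` on `{t > 0} × M'`. -/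
def liftI (ν : ℝ) (αI αJ αK : FormField 𝓘(ℝ, E) M') (I' : EndField 𝓘(ℝ, E) M') :
    EndField (prodModel E) (halfSpace × M') :=
  liftEnd (connForm ν αI αJ αK) quatI I'

/-- The structure `J` on `{t > 0} × M'`. -/
def liftJ (ν : ℝ) (αI αJ αK : FormField 𝓘(ℝ, E) M') (J' : EndField 𝓘(ℝ, E) M') :
    EndField (prodModel E) (halfSpace × M') :=
  liftEnd (connForm ν αI αJ αK) quatJ J'

/-- The structure `K` on `{t > 0} × M'`. -/
def liftK (ν : ℝ) (αI αJ αK : FormField 𝓘(ℝ, E) M') (K' : EndField 𝓘(ℝ, E) M') :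
    EndField (prodModel E) (halfSpace × M') :=
  liftEnd (connForm ν αI αJ αK) quatK K'

/-- The tensor square `ψ ⊗ ψ`. -/
def tensorSq (ψ : FormField (prodModel E) (halfSpace × M')) :
    BilinField (prodModel E) (halfSpace × M') :=
  fun p => (ψ p).smulRight (ψ p)

/-- The metric `g = -(1/(ν t²)) (1 + L) dt ⊗ dt + (1/t) π^* g'`, where
`L = I ⊗ I + J ⊗ J + K ⊗ K`. -/
def metric (ν : ℝ) (g' : BilinField 𝓘(ℝ, E) M')
    (I J K : EndField (prodModel E) (halfSpace × M')) :
    BilinField (prodModel E) (halfSpace × M') :=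
  fun p =>
    (-(1 / (ν * (p.1 : ℍ[ℝ]).re ^ 2))) •
        (tensorSq (dt E M') p + (tensorSq (actForm I (dt E M')) p +
          tensorSq (actForm J (dt E M')) p + tensorSq (actForm K (dt E M')) p)) +
      (1 / (p.1 : ℍ[ℝ]).re) • pullBilin g' p

end Construction

end HHqK

end

/-! Write θ_0, θ_1, θ_2 for the forms du - ν α_I, dv - ν α_J, dw - ν α_K (pullbacks omitted) and
A_0, A_1, A_2 for I, J, K, with indices modulo 3. Together with dt and the projection to M', the θ_i
form an adapted coframe: A_i permutes dt, θ_0, θ_1, θ_2 up to sign and acts as its counterpart A_i'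
on the M'-component, while g is a multiple of the sum of their squares plus g'/t. The quaternion
relations, orthogonality and positivity (where the sign of ν enters) are therefore pointwise
algebra. The first-order input is dθ_i = -ν Ω_i', which is dα = Ω, and ∇'A_i' = 0.

The Levi-Civita connection of g has a closed form, `modelChristoffel`, recognised by uniqueness of
the torsion free metric connection (`christoffel_modelMetricField`). It gives the central formula
(`nablaEnd_modelEndField`), with a_i = θ_i / t: ∇A_i = a_{i+2} ⊗ A_{i+1} - a_{i+1} ⊗ A_{i+2}. Hence
the span is parallel. The relations a_{i+2} ∘ A_i = a_{i+1} and a_{i+1} ∘ A_i = -a_{i+2} make the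
Nijenhuis tensors vanish. The Lee form is half the trace of a sum of two rank one maps, equal to
-dt/t for every i.

For the curvature, da_i + a_{i+1} ∧ a_{i+2} = -ν ω_i with ω_i the Kähler form of (g, A_i)
(`extDerivForm_modelConnForm`). This determines the commutators [R(X,Y), A_i]
(`curvature_commutator_frame`), and these together with the first Bianchi identity determine
Ric(X,Y) + Ric(AY,AX) (`ricci_of_commutators`). Summing over an orthonormal basis and its image
under A yields s = ν d(d+8)/4 in dimension d, that is 4n(n+2)ν for d = 4n; the Einstein property is
not needed. Finally the metric dual of -d ln t is ν t ∂_t, so its square norm is -ν.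

The computation is made over a coordinate domain of M'. It transfers to the manifold because every
chart of the half-space is the inclusion into ℍ. -/

noncomputable section

namespace HHqK

/-! ### Levi-Civita connection and curvature in coordinates -/

section CoordinateGeometry

variable {F : Type*} [NormedAddCommGroup F] [NormedSpace ℝ F]

/-- A bilinear form is positive definite. -/
def PosDefForm (b : F →L[ℝ] F →L[ℝ] ℝ) : Prop := ∀ X, X ≠ 0 → 0 < b X X

/-- A definite form has trivial kernel, and F and its dual have equal dimension. This makes
`ContinuousLinearMap.inverse`, which is zero on non-invertible maps, a genuine inverse, so that ♯
has its intended meaning. -/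
theorem PosDefForm.exists_equiv [FiniteDimensional ℝ F] {b : F →L[ℝ] F →L[ℝ] ℝ}
    (hb : PosDefForm b) : ∃ e : F ≃L[ℝ] (F →L[ℝ] ℝ), (e : F →L[ℝ] (F →L[ℝ] ℝ)) = b := by
  have hinj : Function.Injective b.toLinearMap := by
    rw [← LinearMap.ker_eq_bot, LinearMap.ker_eq_bot']
    intro X hX
    by_contra h
    have h1 := hb X h
    have h2 : b X = 0 := hX
    rw [h2] at h1
    simp at h1
  have hfin : Module.finrank ℝ F = Module.finrank ℝ (F →L[ℝ] ℝ) := by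
    rw [← (LinearMap.toContinuousLinearMap (𝕜 := ℝ) (E := F) (F' := ℝ)).finrank_eq]
    exact (Subspace.dual_finrank_eq (K := ℝ) (V := F)).symm
  refine ⟨(LinearMap.linearEquivOfInjective b.toLinearMap hinj hfin).toContinuousLinearEquiv, ?_⟩
  ext X Y
  rfl

theorem PosDefForm.inverse_apply [FiniteDimensional ℝ F] {b : F →L[ℝ] F →L[ℝ] ℝ}
    (hb : PosDefForm b) (X : F) : b.inverse (b X) = X := by
  obtain ⟨e, rfl⟩ := hb.exists_equiv
  simp

theorem PosDefForm.apply_inverse [FiniteDimensional ℝ F] {b : F →L[ℝ] F →L[ℝ] ℝ}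
    (hb : PosDefForm b) (ψ : F →L[ℝ] ℝ) : b (b.inverse ψ) = ψ := by
  obtain ⟨e, rfl⟩ := hb.exists_equiv
  simp

theorem PosDefForm.ext {b : F →L[ℝ] F →L[ℝ] ℝ}
    (hb : PosDefForm b) {X Y : F} (h : ∀ Z, b X Z = b Y Z) : X = Y := by
  by_contra hne
  have h1 := hb (X - Y) (sub_ne_zero.2 hne)
  simp [h] at h1

theorem christoffel_apply_apply [FiniteDimensional ℝ F] {g : F → F →L[ℝ] F →L[ℝ] ℝ} {y : F}
    (hg : PosDefForm (g y)) (X Y Z : F) :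
    g y (christoffel g y X Y) Z = christoffelLower g y X Y Z := by
  change g y ((g y).inverse (christoffelLower g y X Y)) Z = _
  rw [hg.apply_inverse]

/-- Symmetry is required near `y` and not only at `y`, because it is differentiated. -/
theorem fderiv_bilin_symm {g : F → F →L[ℝ] F →L[ℝ] ℝ} {y : F}
    (hg : DifferentiableAt ℝ g y) (hs : ∀ᶠ z in nhds y, ∀ X Y, g z X Y = g z Y X) (X Y Z : F) :
    fderiv ℝ g y X Y Z = fderiv ℝ g y X Z Y := by
  have h (Y Z : F) : HasFDerivAt (fun z => g z Y Z)
      (((ContinuousLinearMap.apply ℝ ℝ Z) ∘L (ContinuousLinearMap.apply ℝ (F →L[ℝ] ℝ) Y)) ∘L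
        fderiv ℝ g y) y :=
    ((ContinuousLinearMap.apply ℝ ℝ Z) ∘L
      (ContinuousLinearMap.apply ℝ (F →L[ℝ] ℝ) Y)).hasFDerivAt.comp y hg.hasFDerivAt
  have h1 := (h Y Z).congr_of_eventuallyEq (f₁ := fun z => g z Z Y)
    (hs.mono fun z hz => hz Z Y)
  have h2 := (h Z Y).unique h1
  exact (DFunLike.congr_fun h2 X).symm

/-- The Levi-Civita connection is torsion free. -/
theorem christoffel_symm [FiniteDimensional ℝ F] {g : F → F →L[ℝ] F →L[ℝ] ℝ} {y : F}
    (hp : PosDefForm (g y))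
    (hg : DifferentiableAt ℝ g y) (hs : ∀ᶠ z in nhds y, ∀ X Y, g z X Y = g z Y X) (X Y : F) :
    christoffel g y X Y = christoffel g y Y X := by
  refine hp.ext fun Z => ?_
  rw [christoffel_apply_apply hp, christoffel_apply_apply hp, christoffelLower_apply,
    christoffelLower_apply, fderiv_bilin_symm hg hs Z X Y]
  ring

/-- The Levi-Civita connection is metric. -/
theorem christoffel_metric [FiniteDimensional ℝ F] {g : F → F →L[ℝ] F →L[ℝ] ℝ} {y : F}
    (hp : PosDefForm (g y))
    (hg : DifferentiableAt ℝ g y) (hs : ∀ᶠ z in nhds y, ∀ X Y, g z X Y = g z Y X) (X Y Z : F) :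
    fderiv ℝ g y X Y Z = g y (christoffel g y X Y) Z + g y Y (christoffel g y X Z) := by
  rw [hs.self_of_nhds Y, christoffel_apply_apply hp, christoffel_apply_apply hp,
    christoffelLower_apply, christoffelLower_apply, fderiv_bilin_symm hg hs X Z Y]
  ring

/-- A torsion free metric connection is the Levi-Civita connection. -/
theorem christoffel_eq [FiniteDimensional ℝ F] {g : F → F →L[ℝ] F →L[ℝ] ℝ} {y : F}
    (hp : PosDefForm (g y)) (hs : ∀ X Y, g y X Y = g y Y X) {Γ : F → F → F}
    (hΓ : ∀ X Y, Γ X Y = Γ Y X)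
    (hm : ∀ X Y Z, fderiv ℝ g y X Y Z = g y (Γ X Y) Z + g y Y (Γ X Z)) (X Y : F) :
    christoffel g y X Y = Γ X Y := by
  refine hp.ext fun Z => ?_
  rw [christoffel_apply_apply hp, christoffelLower_apply, hm, hm, hm, hΓ Y X, hΓ Z X, hΓ Z Y,
    hs Y, hs X (Γ Y Z)]
  ring

/-- Inversion is smooth near an invertible map. The curvature takes `fderiv` of Γ, which carries
information only once Γ is known to be differentiable. -/
theorem contDiffAt_christoffel [FiniteDimensional ℝ F] {g : F → F →L[ℝ] F →L[ℝ] ℝ} {y : F}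
    (hp : PosDefForm (g y)) (hg : ContDiffAt ℝ ∞ g y) : ContDiffAt ℝ ∞ (christoffel g) y := by
  have h1 : ContDiffAt ℝ ∞ (fun z => (g z).inverse) y := by
    obtain ⟨e, he⟩ := hp.exists_equiv
    have := contDiffAt_map_inverse (𝕜 := ℝ) (n := ∞) e
    rw [he] at this
    exact this.comp y hg
  have h2 : ContDiffAt ℝ ∞ (fderiv ℝ g) y := hg.fderiv_right (by simp)
  have h3 : ContDiffAt ℝ ∞ (fun z => (fderiv ℝ g z).flip) y :=
    (ContinuousLinearMap.flipₗᵢ ℝ F F (F →L[ℝ] ℝ)).contDiff.contDiffAt.comp y h2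
  have h4 : ContDiffAt ℝ ∞ (christoffelLower g) y := by
    unfold christoffelLower
    refine ContDiffAt.const_smul (1 / 2 : ℝ) ((h2.add h3).sub ?_)
    exact contDiffAt_const.clm_comp h3
  unfold christoffel
  exact ((ContinuousLinearMap.compL ℝ F (F →L[ℝ] ℝ) F).contDiff.contDiffAt.comp y h1).clm_comp h4

/-- The first Bianchi identity. -/
theorem curvature_bianchi {g : F → F →L[ℝ] F →L[ℝ] ℝ} {y : F}
    (hΓ : DifferentiableAt ℝ (christoffel g) y)
    (hs : ∀ᶠ z in nhds y, ∀ X Y, christoffel g z X Y = christoffel g z Y X) (X Y Z : F) :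
    curvature g y X Y Z + curvature g y Y Z X + curvature g y Z X Y = 0 := by
  have h (Y Z : F) : HasFDerivAt (fun z => christoffel g z Y Z)
      (((ContinuousLinearMap.apply ℝ F Z) ∘L (ContinuousLinearMap.apply ℝ (F →L[ℝ] F) Y)) ∘L
        fderiv ℝ (christoffel g) y) y :=
    ((ContinuousLinearMap.apply ℝ F Z) ∘L
      (ContinuousLinearMap.apply ℝ (F →L[ℝ] F) Y)).hasFDerivAt.comp y hΓ.hasFDerivAt
  have hd (X Y Z : F) :
      fderiv ℝ (christoffel g) y X Y Z = fderiv ℝ (christoffel g) y X Z Y := by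
    have h1 := (h Y Z).congr_of_eventuallyEq (f₁ := fun z => christoffel g z Z Y)
      (hs.mono fun z hz => hz Z Y)
    exact (DFunLike.congr_fun ((h Z Y).unique h1) X).symm
  have hs' := hs.self_of_nhds
  rw [curvature_apply, curvature_apply, curvature_apply, hd X Z Y, hd Y X Z, hd Z Y X,
    hs' Z Y, hs' X Z, hs' Y X]
  abel

/-- The Ricci identity for a field of endomorphisms. -/
theorem curvature_commutator {g : F → F →L[ℝ] F →L[ℝ] ℝ} {A : F → F →L[ℝ] F} {y : F}
    (hΓ : DifferentiableAt ℝ (christoffel g) y) (hA : ContDiffAt ℝ ∞ A y) (X Y Z : F) :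
    curvature g y X Y (A y Z) - A y (curvature g y X Y Z) =
      fderiv ℝ (nablaEnd g A) y X Y Z - fderiv ℝ (nablaEnd g A) y Y X Z
        + (christoffel g y X (nablaEnd g A y Y Z) - nablaEnd g A y Y (christoffel g y X Z))
        - (christoffel g y Y (nablaEnd g A y X Z) - nablaEnd g A y X (christoffel g y Y Z)) := by
  have hA1 : HasFDerivAt A (fderiv ℝ A y) y :=
    (hA.differentiableAt (by simp)).hasFDerivAt
  have hA2' : DifferentiableAt ℝ (fderiv ℝ A) y :=
    (hA.fderiv_right (m := 1) (by norm_cast)).differentiableAt (by simp)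
  have hA2 := hA2'.hasFDerivAt
  -- Second derivatives of A commute, so they disappear after antisymmetrising in X and Y.
  have hsymm (X Y : F) : fderiv ℝ (fderiv ℝ A) y X Y = fderiv ℝ (fderiv ℝ A) y Y X :=
    ((contDiffAt_infty.1 hA 2).isSymmSndFDerivAt (by simp)).eq X Y
  have hN : DifferentiableAt ℝ (nablaEnd g A) y := by
    unfold nablaEnd
    refine (hA2'.add (DifferentiableAt.clm_comp ?_ hΓ)).sub (DifferentiableAt.clm_comp ?_ hΓ)
    · exact (ContinuousLinearMap.compL ℝ F F F).flip.differentiableAt.comp y hA1.differentiableAt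
    · exact (ContinuousLinearMap.compL ℝ F F F).differentiableAt.comp y hA1.differentiableAt
  have key (X Y Z : F) : fderiv ℝ (nablaEnd g A) y X Y Z =
      fderiv ℝ (fderiv ℝ A) y X Y Z + (fderiv ℝ (christoffel g) y X Y (A y Z)
        + christoffel g y Y (fderiv ℝ A y X Z))
        - (fderiv ℝ A y X (christoffel g y Y Z) + A y (fderiv ℝ (christoffel g) y X Y Z)) := by
    have c (v : F) := hasFDerivAt_const (𝕜 := ℝ) v y
    have e1 := (hN.hasFDerivAt.clm_apply (c Y)).clm_apply (c Z)
    have hG := hΓ.hasFDerivAt.clm_apply (c Y)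
    have e2 := ((hA2.clm_apply (c Y)).clm_apply (c Z)).add
      (hG.clm_apply (hA1.clm_apply (c Z))) |>.sub (hA1.clm_apply (hG.clm_apply (c Z)))
    have e3 := e2.congr_of_eventuallyEq (f₁ := fun z => nablaEnd g A z Y Z)
      (Filter.Eventually.of_forall fun z => nablaEnd_apply g A z Y Z)
    have := DFunLike.congr_fun (e1.unique e3) X
    simpa [add_comm, add_left_comm, add_assoc] using this
  rw [key, key, hsymm Y X, curvature_apply, curvature_apply]
  simp only [nablaEnd_apply, map_add, map_sub]
  abel

/-- The Nijenhuis tensor through a torsion free connection. -/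
theorem nijenhuis_eq {g : F → F →L[ℝ] F →L[ℝ] ℝ} {A : F → F →L[ℝ] F} {y : F}
    (hs : ∀ X Y, christoffel g y X Y = christoffel g y Y X) (X Y : F) :
    nijenhuis A y X Y = nablaEnd g A y (A y X) Y - nablaEnd g A y (A y Y) X
      + A y (nablaEnd g A y Y X) - A y (nablaEnd g A y X Y) := by
  simp only [nijenhuis, nablaEnd_apply, map_add, map_sub]
  rw [hs (A y X) (A y Y), hs (A y X) Y, hs (A y Y) X, hs Y X]
  abel

end CoordinateGeometry

/-! ### Curvature of a quaternionic Kähler frame -/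

section QuaternionicFrame

/-- Multiply the commutator by K and take traces. By cyclicity and JK = I, KJ = -I, the left side
becomes 2 tr(I r); on the right K² = -1 contributes -a dim F, and KI = J is traceless. -/
theorem trace_mul_of_commutator {F : Type*} [AddCommGroup F] [Module ℝ F] [FiniteDimensional ℝ F]
    {I J K r : Module.End ℝ F} (hI : I * I = -1) (hJ : J * J = -1) (hIJ : I * J = K)
    (hJI : J * I = -K) {a b : ℝ} (h : r * J - J * r = a • K - b • I) :
    LinearMap.trace ℝ F (I * r) = -(Module.finrank ℝ F / 2) * a := by
  have hKI : K * I = J := by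
    rw [← hIJ, mul_assoc, hJI, ← hIJ, mul_neg, ← mul_assoc, hI]; simp
  have hKJ : K * J = -I := by rw [← hIJ, mul_assoc, hJ]; simp
  have hJK : J * K = I := by
    rw [← neg_neg K, ← hJI, mul_neg, ← mul_assoc, hJ]; simp
  have hKK : K * K = -1 := by
    nth_rewrite 2 [← hIJ]
    rw [← mul_assoc, hKI, hJ]
  have htJ : LinearMap.trace ℝ F J = 0 := by
    have h1 : LinearMap.trace ℝ F (K * I) = LinearMap.trace ℝ F (I * K) :=
      LinearMap.trace_mul_comm ℝ _ _
    have h2 : I * K = -J := by rw [← hIJ, ← mul_assoc, hI]; simp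
    rw [hKI, h2, map_neg] at h1
    linarith
  have h1 := congrArg (fun f => LinearMap.trace ℝ F (K * f)) h
  simp only [mul_sub, mul_smul_comm, map_sub, map_smul, hKI, hKK, map_neg, htJ,
    LinearMap.trace_one, smul_eq_mul] at h1
  rw [← mul_assoc, ← mul_assoc, hKJ, LinearMap.trace_mul_comm, ← mul_assoc, hJK] at h1
  simp only [neg_mul, map_neg] at h1
  linarith

variable {F : Type*} [NormedAddCommGroup F] [NormedSpace ℝ F]

/-- The quaternion relations for endomorphisms. -/
structure IsQuaternionicTriple (A B C : F → F) : Prop where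
  AA : ∀ X, A (A X) = -X
  BB : ∀ X, B (B X) = -X
  CC : ∀ X, C (C X) = -X
  AB : ∀ X, A (B X) = C X
  BA : ∀ X, B (A X) = -C X
  BC : ∀ X, B (C X) = A X
  CB : ∀ X, C (B X) = -A X
  CA : ∀ X, C (A X) = B X
  AC : ∀ X, A (C X) = -B X

theorem IsQuaternionicTriple.of_mul {A B C : F →L[ℝ] F}
    (AA : ∀ X, A (A X) = -X) (BB : ∀ X, B (B X) = -X) (CC : ∀ X, C (C X) = -X)
    (ABC : ∀ X, A (B (C X)) = -X) : IsQuaternionicTriple A B C := by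
  have AB (X) : A (B X) = C X := by
    have := ABC (C X)
    rwa [CC, map_neg, map_neg, neg_inj] at this
  have BC (X) : B (C X) = A X := by
    have := congrArg A (ABC X)
    rwa [AA, map_neg, neg_inj] at this
  have CB (X) : C (B X) = -A X := by
    rw [← AB, BB, map_neg]
  have AC (X) : A (C X) = -B X := by
    rw [← AB, AA]
  have BA (X) : B (A X) = -C X := by
    rw [← BC, BB]
  have CA (X) : C (A X) = B X := by
    rw [← AB, BA, map_neg, AC, neg_neg]
  exact ⟨AA, BB, CC, AB, BA, BC, CB, CA, AC⟩

theorem IsQuaternionicTriple.bilin_skew {A B C : F → F} (h : IsQuaternionicTriple A B C)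
    {b : F →L[ℝ] F →L[ℝ] ℝ} (ho : ∀ X Y, b (A X) (A Y) = b X Y) (X Y : F) :
    b (A X) Y = -b X (A Y) := by
  rw [← ho (A X) Y, h.AA]; simp

theorem exists_orthonormal_basis [FiniteDimensional ℝ F] {b : F →L[ℝ] F →L[ℝ] ℝ}
    (hb : PosDefForm b) (hs : ∀ X Y, b X Y = b Y X) :
    ∃ e : Module.Basis (Fin (Module.finrank ℝ F)) ℝ F,
      ∀ i j, b (e i) (e j) = if i = j then 1 else 0 := by
  have hs' : LinearMap.IsSymm (b.toLinearMap₁₂ : LinearMap.BilinForm ℝ F) := ⟨fun X Y => hs X Y⟩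
  obtain ⟨v, hv⟩ := LinearMap.BilinForm.exists_orthogonal_basis hs'
  have hpos (i) : 0 < b (v i) (v i) := hb _ (v.ne_zero i)
  have hne (i) : (Real.sqrt (b (v i) (v i)))⁻¹ ≠ 0 :=
    inv_ne_zero (Real.sqrt_ne_zero'.2 (hpos i))
  refine ⟨v.unitsSMul fun i => Units.mk0 _ (hne i), fun i j => ?_⟩
  simp only [Module.Basis.unitsSMul_apply, Units.smul_mk0, map_smul, smul_eq_mul,
    smul_apply]
  split_ifs with h
  · subst h
    rw [← mul_assoc, ← mul_inv, Real.mul_self_sqrt (hpos i).le, inv_mul_cancel₀ (hpos i).ne']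
  · have : b (v i) (v j) = 0 := hv h
    simp [this]

theorem trace_eq_sum_orthonormal [FiniteDimensional ℝ F] {ι : Type*} [Fintype ι] [DecidableEq ι]
    {b : F →L[ℝ] F →L[ℝ] ℝ}
    (e : Module.Basis ι ℝ F) (he : ∀ i j, b (e i) (e j) = if i = j then 1 else 0)
    (f : F →ₗ[ℝ] F) : LinearMap.trace ℝ F f = ∑ i, b (e i) (f (e i)) := by
  rw [LinearMap.trace_eq_matrix_trace ℝ e, Matrix.trace]
  refine Finset.sum_congr rfl fun i _ => ?_
  rw [Matrix.diag_apply, LinearMap.toMatrix_apply]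
  have h (X : F) : b (e i) X = e.repr X i := by
    conv_lhs => rw [← e.sum_repr X]
    simp only [map_sum, map_smul, he, smul_eq_mul, mul_ite, mul_one, mul_zero, Finset.sum_ite_eq,
      Finset.mem_univ, if_true]
  rw [h]

/-- If the commutators of the curvature operators with a quaternionic frame are given by
`lam` times the Kähler forms, the Ricci tensor satisfies `Ric(X,Y) + Ric(AY,AX) = -lam (2n+4) g`. -/
theorem ricci_of_commutators [FiniteDimensional ℝ F] {R : F →L[ℝ] F →L[ℝ] F →L[ℝ] F}
    {b : F →L[ℝ] F →L[ℝ] ℝ} {A B C : F →L[ℝ] F} (h : IsQuaternionicTriple A B C)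
    (hs : ∀ X Y, b X Y = b Y X)
    (hA : ∀ X Y, b (A X) (A Y) = b X Y)
    (hR : ∀ X Y Z, R X Y Z = -R Y X Z)
    (hR' : ∀ X Y Z, R X Y Z + R Y Z X + R Z X Y = 0) {lam : ℝ}
    (hRA : ∀ X Y Z, R X Y (A Z) - A (R X Y Z) = (lam * b (C X) Y) • B Z - (lam * b (B X) Y) • C Z)
    (hRB : ∀ X Y Z, R X Y (B Z) - B (R X Y Z) = (lam * b (A X) Y) • C Z - (lam * b (C X) Y) • A Z)
    (X Y : F) :
    LinearMap.trace ℝ F ((R.flip X).flip Y).toLinearMap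
      + LinearMap.trace ℝ F ((R.flip (A Y)).flip (A X)).toLinearMap
      = -(lam * (Module.finrank ℝ F / 2 + 4)) * b X Y := by
  -- The commutator with B alone controls the trace of A ∘ R(X,Y).
  have htr (X Y : F) : LinearMap.trace ℝ F (A.toLinearMap ∘ₗ (R X Y).toLinearMap) =
      -(Module.finrank ℝ F / 2) * (lam * b (A X) Y) := by
    refine trace_mul_of_commutator (I := A.toLinearMap) (J := B.toLinearMap) (K := C.toLinearMap)
      (r := (R X Y).toLinearMap) (b := lam * b (C X) Y) ?_ ?_ ?_ ?_ ?_
    · ext Z; simp [h.AA]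
    · ext Z; simp [h.BB]
    · ext Z; simp [h.AB]
    · ext Z; simp [h.BA]
    · ext Z; simpa using hRB X Y Z
  -- Moving A out of R(Z,X)AY costs two rank one maps in Z. Their traces involve CB = -A and BC = A
  -- and add up to -2 lam b(AY, X).
  have h1 (X Y : F) : LinearMap.trace ℝ F ((R.flip X).flip (A Y)).toLinearMap =
      LinearMap.trace ℝ F (A.toLinearMap ∘ₗ ((R.flip X).flip Y).toLinearMap)
        - 2 * lam * b (A Y) X := by
    have e : ((R.flip X).flip (A Y)).toLinearMap =
        A.toLinearMap ∘ₗ ((R.flip X).flip Y).toLinearMap +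
        (lam • ((b.flip X).toLinearMap ∘ₗ C.toLinearMap).smulRight (B Y)
          - lam • ((b.flip X).toLinearMap ∘ₗ B.toLinearMap).smulRight (C Y)) := by
      ext Z
      have := hRA Z X Y
      rw [sub_eq_iff_eq_add] at this
      simp [this, mul_smul]
      abel
    rw [e, map_add, map_sub, map_smul, map_smul, LinearMap.trace_smulRight,
      LinearMap.trace_smulRight]
    simp [h.CB, h.BC]
    ring
  -- The Bianchi identity turns the antisymmetric part in X, Y into the trace computed in `htr`.
  have h2 (X Y : F) : LinearMap.trace ℝ F (A.toLinearMap ∘ₗ ((R.flip X).flip Y).toLinearMap)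
      - LinearMap.trace ℝ F (A.toLinearMap ∘ₗ ((R.flip Y).flip X).toLinearMap) =
      -LinearMap.trace ℝ F (A.toLinearMap ∘ₗ (R X Y).toLinearMap) := by
    rw [← map_sub, ← map_neg]
    congr 1
    ext Z
    have e1 := hR' X Y Z
    have e2 : R Z X Y - R Z Y X = -R X Y Z := by
      rw [hR Z Y X, sub_neg_eq_add]
      rw [add_assoc] at e1
      rw [eq_neg_iff_add_eq_zero, ← e1]
      abel
    have := congrArg A e2
    simpa using this
  have hsk := h.bilin_skew hA
  have e1 := h1 X (A Y)
  have e2 := h1 (A Y) X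
  have e3 := h2 X (A Y)
  have e4 : ((R.flip X).flip (A (A Y))).toLinearMap = -((R.flip X).flip Y).toLinearMap := by
    ext Z; simp [h.AA]
  rw [e4, map_neg, h.AA, map_neg] at e1
  rw [htr, hA] at e3
  rw [hA] at e2
  simp only [neg_apply] at e1
  rw [hs Y X] at e1
  linear_combination e2 - e1 - e3

theorem curvature_antisymm (g : F → F →L[ℝ] F →L[ℝ] ℝ) (y X Y Z : F) :
    curvature g y X Y Z = -curvature g y Y X Z := by
  rw [curvature_apply, curvature_apply]; abel

/-- The Ricci identity applied to ∇A = c ⊗ B - b ⊗ C. Differentiating the coefficients gives dc and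
db, differentiating B and C gives the quadratic terms; the A-components and the Christoffel terms
cancel on antisymmetrising. What remains is the curvature of the connection forms. -/
theorem curvature_commutator_frame {g : F → F →L[ℝ] F →L[ℝ] ℝ} {A B C : F → F →L[ℝ] F}
    {a b c : F → F →L[ℝ] ℝ} {y : F}
    (hΓ : DifferentiableAt ℝ (christoffel g) y) (hA : ContDiffAt ℝ ∞ A y)
    (hB : DifferentiableAt ℝ B y) (hC : DifferentiableAt ℝ C y)
    (hb : DifferentiableAt ℝ b y) (hc : DifferentiableAt ℝ c y)
    (nA : ∀ᶠ z in nhds y, ∀ X, nablaEnd g A z X = c z X • B z - b z X • C z)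
    (nB : ∀ X, nablaEnd g B y X = a y X • C y - c y X • A y)
    (nC : ∀ X, nablaEnd g C y X = b y X • A y - a y X • B y) (X Y Z : F) :
    curvature g y X Y (A y Z) - A y (curvature g y X Y Z) =
      (extDerivForm c y X Y + (a y X * b y Y - a y Y * b y X)) • B y Z
        - (extDerivForm b y X Y + (c y X * a y Y - c y Y * a y X)) • C y Z := by
  have key (X Y Z : F) : fderiv ℝ (nablaEnd g A) y X Y Z =
      (fderiv ℝ c y X Y) • B y Z + c y Y • fderiv ℝ B y X Z
        - ((fderiv ℝ b y X Y) • C y Z + b y Y • fderiv ℝ C y X Z) := by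
    have hd : HasFDerivAt (fun z => (c z).smulRight (B z) - (b z).smulRight (C z))
        (((ContinuousLinearMap.smulRightL ℝ F (F →L[ℝ] F)).precompR F (c y) (fderiv ℝ B y)
          + (ContinuousLinearMap.smulRightL ℝ F (F →L[ℝ] F)).precompL F (fderiv ℝ c y) (B y))
        - ((ContinuousLinearMap.smulRightL ℝ F (F →L[ℝ] F)).precompR F (b y) (fderiv ℝ C y)
          + (ContinuousLinearMap.smulRightL ℝ F (F →L[ℝ] F)).precompL F (fderiv ℝ b y) (C y))) y :=
      (((ContinuousLinearMap.smulRightL ℝ F (F →L[ℝ] F)).hasFDerivAt_of_bilinear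
        hc.hasFDerivAt hB.hasFDerivAt)).sub
      ((ContinuousLinearMap.smulRightL ℝ F (F →L[ℝ] F)).hasFDerivAt_of_bilinear
        hb.hasFDerivAt hC.hasFDerivAt)
    have h2 := hd.congr_of_eventuallyEq (f₁ := nablaEnd g A) (nA.mono fun z hz => by
      ext1 X; rw [hz]; simp)
    rw [h2.fderiv]
    simp
    abel
  have nA' := nA.self_of_nhds
  -- Plain derivatives of B and C are traded for covariant ones, so that the Christoffel terms can
  -- cancel.
  have dB (X Z : F) : fderiv ℝ B y X Z = a y X • C y Z - c y X • A y Z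
      - christoffel g y X (B y Z) + B y (christoffel g y X Z) := by
    have := nablaEnd_apply g B y X Z
    rw [nB] at this
    simp only [sub_apply, smul_apply] at this
    rw [this]; abel
  have dC (X Z : F) : fderiv ℝ C y X Z = b y X • A y Z - a y X • B y Z
      - christoffel g y X (C y Z) + C y (christoffel g y X Z) := by
    have := nablaEnd_apply g C y X Z
    rw [nC] at this
    simp only [sub_apply, smul_apply] at this
    rw [this]; abel
  rw [curvature_commutator hΓ hA, key, key, nA', nA']
  simp only [dB, dC, extDerivForm, sub_apply, smul_apply,
    map_sub, map_smul]
  module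

/-- The scalar curvature of a metric with a quaternionic frame whose connection forms have
curvature `lam` times the Kähler forms. -/
theorem scalarCurvature_of_frame [FiniteDimensional ℝ F]
    {g : F → F →L[ℝ] F →L[ℝ] ℝ} {A B C : F → F →L[ℝ] F}
    {a b c : F → F →L[ℝ] ℝ} {U : Set F} (hU : IsOpen U) {y : F} (hy : y ∈ U)
    (hg : ∀ z ∈ U, ContDiffAt ℝ ∞ g z)
    (hp : ∀ z ∈ U, PosDefForm (g z)) (hs : ∀ z ∈ U, ∀ X Y, g z X Y = g z Y X)
    (hA : ContDiffAt ℝ ∞ A y) (hB : ContDiffAt ℝ ∞ B y) (hC : ContDiffAt ℝ ∞ C y)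
    (ha : DifferentiableAt ℝ a y) (hb : DifferentiableAt ℝ b y) (hc : DifferentiableAt ℝ c y)
    (hq : IsQuaternionicTriple (A y) (B y) (C y))
    (hoA : ∀ X Y, g y (A y X) (A y Y) = g y X Y)
    (nA : ∀ z ∈ U, ∀ X, nablaEnd g A z X = c z X • B z - b z X • C z)
    (nB : ∀ z ∈ U, ∀ X, nablaEnd g B z X = a z X • C z - c z X • A z)
    (nC : ∀ z ∈ U, ∀ X, nablaEnd g C z X = b z X • A z - a z X • B z) {lam : ℝ}
    (da : ∀ X Y, extDerivForm a y X Y + (b y X * c y Y - b y Y * c y X) = lam * g y (A y X) Y)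
    (db : ∀ X Y, extDerivForm b y X Y + (c y X * a y Y - c y Y * a y X) = lam * g y (B y X) Y)
    (dc : ∀ X Y, extDerivForm c y X Y + (a y X * b y Y - a y Y * b y X) = lam * g y (C y X) Y) :
    scalarCurvature g y = -lam * (Module.finrank ℝ F * (Module.finrank ℝ F + 8)) / 4 := by
  have hUy : ∀ᶠ z in nhds y, z ∈ U := hU.mem_nhds hy
  have hΓ : DifferentiableAt ℝ (christoffel g) y :=
    (contDiffAt_christoffel (hp y hy) (hg y hy)).differentiableAt (by simp)
  have hsy : ∀ z ∈ U, ∀ X Y, christoffel g z X Y = christoffel g z Y X := fun z hz =>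
    christoffel_symm (hp z hz) ((hg z hz).differentiableAt (by simp))
      (Filter.Eventually.mono (hU.mem_nhds hz : ∀ᶠ w in nhds z, w ∈ U) hs)
  have hRA := curvature_commutator_frame hΓ hA (hB.differentiableAt (by simp))
    (hC.differentiableAt (by simp)) hb hc (hUy.mono nA) (nB y hy) (nC y hy)
  -- The hypotheses are invariant under the cyclic permutation A → B → C → A.
  have hRB := curvature_commutator_frame hΓ hB (hC.differentiableAt (by simp))
    (hA.differentiableAt (by simp)) hc ha (hUy.mono nB) (nC y hy) (nA y hy)
  simp only [da, db, dc] at hRA hRB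
  have hric := ricci_of_commutators (R := curvature g y) hq (hs y hy) hoA (curvature_antisymm g y)
    (curvature_bianchi hΓ (hUy.mono hsy)) hRA hRB
  obtain ⟨e, he⟩ := exists_orthonormal_basis (hp y hy) (hs y hy)
  have hinj : Function.Injective (A y) := fun X Y h => by
    have := congrArg (A y) h
    simpa [hq.AA] using this
  let L : F ≃ₗ[ℝ] F := LinearEquiv.ofInjectiveEndo (A y).toLinearMap hinj
  have hL (X : F) : L X = A y X := rfl
  have key (e : Module.Basis (Fin (Module.finrank ℝ F)) ℝ F)
      (he : ∀ i j, g y (e i) (e j) = if i = j then 1 else 0) :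
      scalarCurvature g y = ∑ i, ricci g y (e i) (e i) := by
    rw [scalarCurvature, trace_eq_sum_orthonormal e he]
    refine Finset.sum_congr rfl fun i _ => ?_
    rw [hs y hy]
    simp [(hp y hy).apply_inverse]
  have k1 := key e he
  -- As A is orthogonal, A e_i is again an orthonormal basis. Adding the two expressions for s
  -- leaves only the sums Ric(e_i,e_i) + Ric(Ae_i,Ae_i), which are known.
  have k2 := key (e.map L) (fun i j => by simp [hL, hoA, he])
  have : scalarCurvature g y + scalarCurvature g y =
      ∑ i, (ricci g y (e i) (e i) + ricci g y (A y (e i)) (A y (e i))) := by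
    rw [Finset.sum_add_distrib, ← k1]
    congr 1
  have hr (i) : ricci g y (e i) (e i) + ricci g y (A y (e i)) (A y (e i)) =
      -(lam * (Module.finrank ℝ F / 2 + 4)) := by
    have := hric (e i) (e i)
    rw [he, if_pos rfl, mul_one] at this
    exact this
  simp only [hr, Finset.sum_const, Finset.card_univ, Fintype.card_fin, nsmul_eq_mul] at this
  linarith

end QuaternionicFrame

/-! ### The model: the half-space bundle over a coordinate domain -/

section Model

variable {E : Type*} [NormedAddCommGroup E] [NormedSpace ℝ E]

/-- The real part of a quaternion, as a continuous linear form. -/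
def quatRe : ℍ[ℝ] →L[ℝ] ℝ := LinearMap.toContinuousLinearMap
  { toFun := fun q => q.re, map_add' := fun _ _ => rfl, map_smul' := fun _ _ => by simp }

/-- The imaginary components of a quaternion, as continuous linear forms. -/
def quatIm : Fin 3 → ℍ[ℝ] →L[ℝ] ℝ
  | 0 => LinearMap.toContinuousLinearMap
    { toFun := fun q => q.imI, map_add' := fun _ _ => rfl, map_smul' := fun _ _ => by simp }
  | 1 => LinearMap.toContinuousLinearMap
    { toFun := fun q => q.imJ, map_add' := fun _ _ => rfl, map_smul' := fun _ _ => by simp }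
  | 2 => LinearMap.toContinuousLinearMap
    { toFun := fun q => q.imK, map_add' := fun _ _ => rfl, map_smul' := fun _ _ => by simp }

/-- The imaginary units. -/
def quatUnit : Fin 3 → ℍ[ℝ]
  | 0 => quatI
  | 1 => quatJ
  | 2 => quatK

@[simp] theorem quatRe_apply (q : ℍ[ℝ]) : quatRe q = q.re := rfl
@[simp] theorem quatIm_zero (q : ℍ[ℝ]) : quatIm 0 q = q.imI := rfl
@[simp] theorem quatIm_one (q : ℍ[ℝ]) : quatIm 1 q = q.imJ := rfl
@[simp] theorem quatIm_two (q : ℍ[ℝ]) : quatIm 2 q = q.imK := rfl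

variable (E) in
/-- The form `dt` on the model. -/
def thetaRe : ℍ[ℝ] × E →L[ℝ] ℝ := quatRe ∘L ContinuousLinearMap.fst ℝ ℍ[ℝ] E

/-- The imaginary components of `dq - ν (β₀ i + β₁ j + β₂ k)`. -/
def thetaIm (ν : ℝ) (β : Fin 3 → E →L[ℝ] ℝ) (i : Fin 3) : ℍ[ℝ] × E →L[ℝ] ℝ :=
  quatIm i ∘L ContinuousLinearMap.fst ℝ ℍ[ℝ] E - ν • (β i ∘L ContinuousLinearMap.snd ℝ ℍ[ℝ] E)

theorem thetaRe_apply (X : ℍ[ℝ] × E) : thetaRe E X = X.1.re := rfl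

theorem thetaIm_apply (ν : ℝ) (β : Fin 3 → E →L[ℝ] ℝ) (i : Fin 3) (X : ℍ[ℝ] × E) :
    thetaIm ν β i X = quatIm i X.1 - ν * β i X.2 := rfl

/-- The coframe property: later identities between tangent vectors of the model are checked on dt,
the θ_i and the E-component. -/
theorem theta_ext {ν : ℝ} {β : Fin 3 → E →L[ℝ] ℝ} {X Y : ℍ[ℝ] × E}
    (h0 : thetaRe E X = thetaRe E Y) (hi : ∀ i, thetaIm ν β i X = thetaIm ν β i Y)
    (h2 : X.2 = Y.2) : X = Y := by
  have h (i) : quatIm i X.1 = quatIm i Y.1 := by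
    have := hi i
    rw [thetaIm_apply, thetaIm_apply, h2] at this
    linarith
  exact Prod.ext (QuaternionAlgebra.ext h0 (h 0) (h 1) (h 2)) h2

/-- The tangent vector with given components. -/
def thetaVec (ν : ℝ) (β : Fin 3 → E →L[ℝ] ℝ) (r : ℝ) (s : Fin 3 → ℝ) (x : E) : ℍ[ℝ] × E :=
  (⟨r, s 0 + ν * β 0 x, s 1 + ν * β 1 x, s 2 + ν * β 2 x⟩, x)

theorem thetaRe_thetaVec (ν : ℝ) (β : Fin 3 → E →L[ℝ] ℝ) (r : ℝ) (s : Fin 3 → ℝ) (x : E) :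
    thetaRe E (thetaVec ν β r s x) = r := rfl

theorem thetaIm_thetaVec (ν : ℝ) (β : Fin 3 → E →L[ℝ] ℝ) (r : ℝ) (s : Fin 3 → ℝ) (x : E)
    (i : Fin 3) : thetaIm ν β i (thetaVec ν β r s x) = s i := by
  fin_cases i <;> exact add_sub_cancel_right _ _

theorem thetaVec_snd (ν : ℝ) (β : Fin 3 → E →L[ℝ] ℝ) (r : ℝ) (s : Fin 3 → ℝ) (x : E) :
    (thetaVec ν β r s x).2 = x := rfl

theorem quatI_components : quatI.re = 0 ∧ quatI.imI = 1 ∧ quatI.imJ = 0 ∧ quatI.imK = 0 :=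
  ⟨rfl, rfl, rfl, rfl⟩

theorem quatJ_components : quatJ.re = 0 ∧ quatJ.imI = 0 ∧ quatJ.imJ = 1 ∧ quatJ.imK = 0 :=
  ⟨rfl, rfl, rfl, rfl⟩

theorem quatK_components : quatK.re = 0 ∧ quatK.imI = 0 ∧ quatK.imJ = 0 ∧ quatK.imK = 1 :=
  ⟨rfl, rfl, rfl, rfl⟩

/-- The quaternion valued form `ν (β₀ i + β₁ j + β₂ k)`. -/
def modelForm (ν : ℝ) (β : Fin 3 → E →L[ℝ] ℝ) : E →L[ℝ] ℍ[ℝ] :=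
  ν • ((β 0).smulRight quatI + (β 1).smulRight quatJ + (β 2).smulRight quatK)

/-- The lift of the endomorphism `B`, with the quaternion `a` acting on the fibres. -/
def modelEnd (η : E →L[ℝ] ℍ[ℝ]) (a : ℍ[ℝ]) (B : E →L[ℝ] E) : ℍ[ℝ] × E →L[ℝ] ℍ[ℝ] × E :=
  (η ∘L B ∘L ContinuousLinearMap.snd ℝ ℍ[ℝ] E -
    (ContinuousLinearMap.mul ℝ ℍ[ℝ]).flip a ∘L
      (ContinuousLinearMap.fst ℝ ℍ[ℝ] E - η ∘L ContinuousLinearMap.snd ℝ ℍ[ℝ] E)).prod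
      (B ∘L ContinuousLinearMap.snd ℝ ℍ[ℝ] E)

theorem modelEnd_snd (η : E →L[ℝ] ℍ[ℝ]) (a : ℍ[ℝ]) (B : E →L[ℝ] E) (X : ℍ[ℝ] × E) :
    (modelEnd η a B X).2 = B X.2 := rfl

theorem modelEnd_fst (η : E →L[ℝ] ℍ[ℝ]) (a : ℍ[ℝ]) (B : E →L[ℝ] E) (X : ℍ[ℝ] × E) :
    (modelEnd η a B X).1 = η (B X.2) - (X.1 - η X.2) * a := rfl

theorem modelForm_components (ν : ℝ) (β : Fin 3 → E →L[ℝ] ℝ) (x : E) :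
    (modelForm ν β x).re = 0 ∧ (modelForm ν β x).imI = ν * β 0 x ∧
      (modelForm ν β x).imJ = ν * β 1 x ∧ (modelForm ν β x).imK = ν * β 2 x := by
  simp [modelForm, quatI_components, quatJ_components, quatK_components]

/-- Right multiplication by minus an imaginary unit, written out in components. Addition in `Fin 3`
wraps around, so one table serves I, J and K. -/
theorem theta_modelEnd (ν : ℝ) (β : Fin 3 → E →L[ℝ] ℝ) (i : Fin 3) (B : E →L[ℝ] E)
    (X : ℍ[ℝ] × E) :
    thetaRe E (modelEnd (modelForm ν β) (quatUnit i) B X) = thetaIm ν β i X ∧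
    thetaIm ν β i (modelEnd (modelForm ν β) (quatUnit i) B X) = -thetaRe E X ∧
    thetaIm ν β (i + 1) (modelEnd (modelForm ν β) (quatUnit i) B X) = -thetaIm ν β (i + 2) X ∧
    thetaIm ν β (i + 2) (modelEnd (modelForm ν β) (quatUnit i) B X) = thetaIm ν β (i + 1) X := by
  fin_cases i <;>
    simp [thetaRe_apply, thetaIm_apply, modelEnd_fst, modelEnd_snd, modelForm_components, quatUnit,
      quatI_components, quatJ_components, quatK_components]

/-- The metric of the model. -/
def modelMetric (ν t : ℝ) (β : Fin 3 → E →L[ℝ] ℝ) (b : E →L[ℝ] E →L[ℝ] ℝ) :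
    ℍ[ℝ] × E →L[ℝ] ℍ[ℝ] × E →L[ℝ] ℝ :=
  (-(1 / (ν * t ^ 2))) • ((thetaRe E).smulRight (thetaRe E) +
      ∑ i, (thetaIm ν β i).smulRight (thetaIm ν β i)) +
    (1 / t) • b.bilinearComp (ContinuousLinearMap.snd ℝ ℍ[ℝ] E) (ContinuousLinearMap.snd ℝ ℍ[ℝ] E)

theorem modelMetric_apply (ν t : ℝ) (β : Fin 3 → E →L[ℝ] ℝ) (b : E →L[ℝ] E →L[ℝ] ℝ)
    (X Y : ℍ[ℝ] × E) : modelMetric ν t β b X Y =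
      -(1 / (ν * t ^ 2)) * (thetaRe E X * thetaRe E Y + ∑ i, thetaIm ν β i X * thetaIm ν β i Y) +
        1 / t * b X.2 Y.2 := by
  simp [modelMetric, mul_add]

theorem modelMetric_symm {b : E →L[ℝ] E →L[ℝ] ℝ} (hb : ∀ X Y, b X Y = b Y X) (ν t : ℝ)
    (β : Fin 3 → E →L[ℝ] ℝ) (X Y : ℍ[ℝ] × E) :
    modelMetric ν t β b X Y = modelMetric ν t β b Y X := by
  simp only [modelMetric_apply, hb X.2 Y.2, mul_comm]

theorem modelMetric_posDef {b : E →L[ℝ] E →L[ℝ] ℝ} (hb : PosDefForm b) {ν t : ℝ} (hν : ν < 0)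
    (ht : 0 < t) (β : Fin 3 → E →L[ℝ] ℝ) : PosDefForm (modelMetric ν t β b) := by
  intro X hX
  have hc : 0 < -(1 / (ν * t ^ 2)) := by
    rw [neg_pos, one_div, inv_lt_zero]
    exact mul_neg_of_neg_of_pos hν (by positivity)
  have h1 : 0 ≤ ∑ i, thetaIm ν β i X * thetaIm ν β i X :=
    Finset.sum_nonneg fun i _ => mul_self_nonneg _
  have h2 : 0 ≤ thetaRe E X * thetaRe E X := mul_self_nonneg _
  have ht' : 0 < 1 / t := by positivity
  rw [modelMetric_apply]
  -- Both coefficients are positive since ν < 0 < t. If the E-component vanishes, the squares of the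
  -- coframe must be positive; otherwise b is.
  by_cases h : X.2 = 0
  · have h3 : 0 < thetaRe E X * thetaRe E X + ∑ i, thetaIm ν β i X * thetaIm ν β i X := by
      refine lt_of_le_of_ne (add_nonneg h2 h1) fun h0 => hX ?_
      have h4 : ∑ i, thetaIm ν β i X * thetaIm ν β i X = 0 := by linarith
      have h5 : thetaRe E X * thetaRe E X = 0 := by linarith
      rw [Finset.sum_eq_zero_iff_of_nonneg fun i _ => mul_self_nonneg _] at h4
      refine theta_ext (ν := ν) (β := β) ?_ (fun i => ?_) h
      · simpa using h5
      · simpa using h4 i (Finset.mem_univ i)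
    simp only [h, map_zero, mul_zero, add_zero]
    positivity
  · have := hb _ h
    have := mul_nonneg hc.le (add_nonneg h2 h1)
    positivity

/-- Reordering by i, i+1, i+2 allows a computation for A_i to be done once for all three structures.
-/
theorem sum_fin_three_cyclic {G : Type*} [AddCommMonoid G] (f : Fin 3 → G) (i : Fin 3) :
    ∑ j, f j = f i + f (i + 1) + f (i + 2) := by
  fin_cases i <;> simp [Fin.sum_univ_three] <;> abel

theorem forall_fin_three_cyclic {p : Fin 3 → Prop} (i : Fin 3) (h0 : p i) (h1 : p (i + 1))
    (h2 : p (i + 2)) (j : Fin 3) : p j := by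
  fin_cases i <;> fin_cases j <;> first | exact h0 | exact h1 | exact h2

theorem modelMetric_orth {b : E →L[ℝ] E →L[ℝ] ℝ} {B : E →L[ℝ] E}
    (hB : ∀ X Y, b (B X) (B Y) = b X Y) (ν t : ℝ) (β : Fin 3 → E →L[ℝ] ℝ) (i : Fin 3)
    (X Y : ℍ[ℝ] × E) :
    modelMetric ν t β b (modelEnd (modelForm ν β) (quatUnit i) B X)
      (modelEnd (modelForm ν β) (quatUnit i) B Y) = modelMetric ν t β b X Y := by
  obtain ⟨h1, h2, h3, h4⟩ := theta_modelEnd ν β i B X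
  obtain ⟨k1, k2, k3, k4⟩ := theta_modelEnd ν β i B Y
  simp only [modelMetric_apply, sum_fin_three_cyclic _ i, h1, h2, h3, h4, k1, k2, k3, k4,
    modelEnd_snd, hB]
  ring

theorem modelEnd_sq {B : E →L[ℝ] E} (hB : ∀ X, B (B X) = -X) (ν : ℝ) (β : Fin 3 → E →L[ℝ] ℝ)
    (i : Fin 3) (X : ℍ[ℝ] × E) :
    modelEnd (modelForm ν β) (quatUnit i) B (modelEnd (modelForm ν β) (quatUnit i) B X) = -X := by
  obtain ⟨h1, h2, h3, h4⟩ := theta_modelEnd ν β i B X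
  obtain ⟨k1, k2, k3, k4⟩ := theta_modelEnd ν β i B (modelEnd (modelForm ν β) (quatUnit i) B X)
  refine theta_ext (ν := ν) (β := β) ?_ (forall_fin_three_cyclic i ?_ ?_ ?_) ?_
  · rw [k1, h2, map_neg]
  · rw [k2, h1, map_neg]
  · rw [k3, h4, map_neg]
  · rw [k4, h3, map_neg]
  · rw [modelEnd_snd, modelEnd_snd, hB]; rfl

theorem fin_three_add (i : Fin 3) :
    i + 1 + 1 = i + 2 ∧ i + 1 + 2 = i ∧ i + 2 + 1 = i ∧ i + 2 + 2 = i + 1 := by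
  fin_cases i <;> decide

/-- Right multiplications compose in reverse order; the minus sign in Θ(AX) = -Θ(X)a compensates,
since Θ(X)ji = -Θ(X)k. -/
theorem modelEnd_mul {B B' B'' : E →L[ℝ] E} (hB : ∀ X, B (B' X) = B'' X) (ν : ℝ)
    (β : Fin 3 → E →L[ℝ] ℝ) (i : Fin 3) (X : ℍ[ℝ] × E) :
    modelEnd (modelForm ν β) (quatUnit i) B
      (modelEnd (modelForm ν β) (quatUnit (i + 1)) B' X) =
      modelEnd (modelForm ν β) (quatUnit (i + 2)) B'' X := by
  obtain ⟨h1, h2, h3, h4⟩ := theta_modelEnd ν β (i + 1) B' X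
  obtain ⟨l1, l2, l3, l4⟩ := theta_modelEnd ν β (i + 2) B'' X
  obtain ⟨k1, k2, k3, k4⟩ :=
    theta_modelEnd ν β i B (modelEnd (modelForm ν β) (quatUnit (i + 1)) B' X)
  obtain ⟨f1, f2, f3, f4⟩ := fin_three_add i
  simp only [f1, f2, f3, f4] at h1 h2 h3 h4 l1 l2 l3 l4 k1 k2 k3 k4
  refine theta_ext (ν := ν) (β := β) ?_ (forall_fin_three_cyclic i ?_ ?_ ?_) ?_
  · rw [k1, h4, l1]
  · rw [k2, h1, l3]
  · rw [k3, h3, l4, neg_neg]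
  · rw [k4, h2, l2]
  · rw [modelEnd_snd, modelEnd_snd, modelEnd_snd, hB]

end Model

/-! ### Connection and curvature of the model -/

section ModelGeometry

/-- The part of `{t > 0} × E` over `V`. -/
def halfDomain {G : Type*} (V : Set G) : Set (ℍ[ℝ] × G) := {z | 0 < z.1.re ∧ z.2 ∈ V}

theorem isOpen_halfDomain {G : Type*} [TopologicalSpace G] {V : Set G} (hV : IsOpen V) : IsOpen (halfDomain V) :=
  (isOpen_lt continuous_const (Quaternion.continuous_re.comp continuous_fst)).inter
    (hV.preimage continuous_snd)

variable {E : Type*} [NormedAddCommGroup E] [NormedSpace ℝ E]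

/-- The coordinate expression of a hyper-Kähler structure with primitives `α` of its Kähler
forms. -/
structure HyperKahlerChart (V : Set E) (h : E → E →L[ℝ] E →L[ℝ] ℝ) (A : Fin 3 → E → E →L[ℝ] E)
    (α : Fin 3 → E → E →L[ℝ] ℝ) : Prop where
  isOpen : IsOpen V
  smooth_metric : ContDiffOn ℝ ∞ h V
  smooth_end : ∀ i, ContDiffOn ℝ ∞ (A i) V
  smooth_form : ∀ i, ContDiffOn ℝ ∞ (α i) V
  symm : ∀ y ∈ V, ∀ X Y, h y X Y = h y Y X
  posDef : ∀ y ∈ V, PosDefForm (h y)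
  triple : ∀ y ∈ V, ∀ i, IsQuaternionicTriple (A i y) (A (i + 1) y) (A (i + 2) y)
  orth : ∀ y ∈ V, ∀ i X Y, h y (A i y X) (A i y Y) = h y X Y
  parallel : ∀ y ∈ V, ∀ i, nablaEnd h (A i) y = 0
  primitive : ∀ y ∈ V, ∀ i X Y, extDerivForm (α i) y X Y = h y (A i y X) Y

/-- The metric of the model as a tensor field. -/
def modelMetricField (ν : ℝ) (h : E → E →L[ℝ] E →L[ℝ] ℝ) (α : Fin 3 → E → E →L[ℝ] ℝ)
    (z : ℍ[ℝ] × E) : ℍ[ℝ] × E →L[ℝ] ℍ[ℝ] × E →L[ℝ] ℝ :=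
  modelMetric ν z.1.re (fun i => α i z.2) (h z.2)

/-- The almost complex structures of the model as tensor fields. -/
def modelEndField (ν : ℝ) (A : Fin 3 → E → E →L[ℝ] E) (α : Fin 3 → E → E →L[ℝ] ℝ) (i : Fin 3)
    (z : ℍ[ℝ] × E) : ℍ[ℝ] × E →L[ℝ] ℍ[ℝ] × E :=
  modelEnd (modelForm ν fun i => α i z.2) (quatUnit i) (A i z.2)

/-- The connection forms of the model. -/
def modelConnForm (ν : ℝ) (α : Fin 3 → E → E →L[ℝ] ℝ) (i : Fin 3) (z : ℍ[ℝ] × E) :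
    ℍ[ℝ] × E →L[ℝ] ℝ :=
  (1 / z.1.re) • thetaIm ν (fun i => α i z.2) i

variable {V : Set E} {h : E → E →L[ℝ] E →L[ℝ] ℝ} {A : Fin 3 → E → E →L[ℝ] E}
  {α : Fin 3 → E → E →L[ℝ] ℝ} {ν : ℝ}

theorem contDiffAt_re (z : ℍ[ℝ] × E) : ContDiffAt ℝ ∞ (fun z : ℍ[ℝ] × E => z.1.re) z :=
  (thetaRe E).contDiff.contDiffAt

theorem HyperKahlerChart.contDiffAt_form (hV : HyperKahlerChart V h A α) {z : ℍ[ℝ] × E}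
    (hz : z ∈ halfDomain V) (i : Fin 3) :
    ContDiffAt ℝ ∞ (fun z : ℍ[ℝ] × E => α i z.2) z :=
  ((hV.smooth_form i).contDiffAt (hV.isOpen.mem_nhds hz.2)).comp z contDiffAt_snd

theorem HyperKahlerChart.contDiffAt_thetaIm (hV : HyperKahlerChart V h A α) (ν : ℝ)
    {z : ℍ[ℝ] × E} (hz : z ∈ halfDomain V) (i : Fin 3) :
    ContDiffAt ℝ ∞ (fun z : ℍ[ℝ] × E => thetaIm ν (fun i => α i z.2) i) z := by
  unfold thetaIm
  exact contDiffAt_const.sub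
    (ContDiffAt.const_smul ν ((hV.contDiffAt_form hz i).clm_comp contDiffAt_const))

theorem HyperKahlerChart.contDiffAt_modelMetricField (hV : HyperKahlerChart V h A α) (hν : ν < 0)
    {z : ℍ[ℝ] × E} (hz : z ∈ halfDomain V) : ContDiffAt ℝ ∞ (modelMetricField ν h α) z := by
  have hh : ContDiffAt ℝ ∞ (fun z : ℍ[ℝ] × E => h z.2) z :=
    (hV.smooth_metric.contDiffAt (hV.isOpen.mem_nhds hz.2)).comp z contDiffAt_snd
  have hr := contDiffAt_re z
  have ht : z.1.re ≠ 0 := hz.1.ne'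
  have hc : ContDiffAt ℝ ∞ (fun z : ℍ[ℝ] × E => -(1 / (ν * z.1.re ^ 2))) z :=
    (contDiffAt_const.div (contDiffAt_const.mul (hr.pow 2))
      (mul_ne_zero hν.ne (pow_ne_zero 2 ht))).neg
  have hc' : ContDiffAt ℝ ∞ (fun z : ℍ[ℝ] × E => 1 / z.1.re) z := contDiffAt_const.div hr ht
  unfold modelMetricField modelMetric
  refine (hc.smul (contDiffAt_const.add (ContDiffAt.sum fun i _ => ?_))).add (hc'.smul ?_)
  · exact (hV.contDiffAt_thetaIm ν hz i).smulRight (hV.contDiffAt_thetaIm ν hz i)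
  · have e : (fun z : ℍ[ℝ] × E => (h z.2).bilinearComp (ContinuousLinearMap.snd ℝ ℍ[ℝ] E)
        (ContinuousLinearMap.snd ℝ ℍ[ℝ] E)) = fun z : ℍ[ℝ] × E =>
        (((ContinuousLinearMap.compL ℝ (ℍ[ℝ] × E) E ℝ).flip
          (ContinuousLinearMap.snd ℝ ℍ[ℝ] E)) ∘L (h z.2)) ∘L ContinuousLinearMap.snd ℝ ℍ[ℝ] E := by
      ext <;> rfl
    rw [e]
    exact (contDiffAt_const.clm_comp hh).clm_comp contDiffAt_const

theorem HyperKahlerChart.contDiffAt_modelEndField (hV : HyperKahlerChart V h A α) (ν : ℝ)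
    {z : ℍ[ℝ] × E} (hz : z ∈ halfDomain V) (i : Fin 3) :
    ContDiffAt ℝ ∞ (modelEndField ν A α i) z := by
  have hA : ContDiffAt ℝ ∞ (fun z : ℍ[ℝ] × E => A i z.2) z :=
    ((hV.smooth_end i).contDiffAt (hV.isOpen.mem_nhds hz.2)).comp z contDiffAt_snd
  have hη : ContDiffAt ℝ ∞ (fun z : ℍ[ℝ] × E => modelForm ν fun i => α i z.2) z := by
    unfold modelForm
    exact ContDiffAt.const_smul ν ((((hV.contDiffAt_form hz 0).smulRight contDiffAt_const).add
      ((hV.contDiffAt_form hz 1).smulRight contDiffAt_const)).add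
      ((hV.contDiffAt_form hz 2).smulRight contDiffAt_const))
  have hAs := hA.clm_comp (contDiffAt_const (c := ContinuousLinearMap.snd ℝ ℍ[ℝ] E))
  have hηs := hη.clm_comp (contDiffAt_const (c := ContinuousLinearMap.snd ℝ ℍ[ℝ] E))
  unfold modelEndField modelEnd
  have e (f : ℍ[ℝ] × E →L[ℝ] ℍ[ℝ]) (g : ℍ[ℝ] × E →L[ℝ] E) : f.prod g =
      ContinuousLinearMap.inl ℝ ℍ[ℝ] E ∘L f + ContinuousLinearMap.inr ℝ ℍ[ℝ] E ∘L g := by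
    ext <;> simp
  simp only [e]
  exact (contDiffAt_const.clm_comp ((hη.clm_comp hAs).sub
    (contDiffAt_const.clm_comp (contDiffAt_const.sub hηs)))).add (contDiffAt_const.clm_comp hAs)

theorem HyperKahlerChart.hasFDerivAt_thetaIm (hV : HyperKahlerChart V h A α) (ν : ℝ)
    {z : ℍ[ℝ] × E} (hz : z ∈ halfDomain V) (i : Fin 3) (Y : ℍ[ℝ] × E) :
    HasFDerivAt (fun z : ℍ[ℝ] × E => thetaIm ν (fun i => α i z.2) i Y)
      (-ν • (((fderiv ℝ (α i) z.2).flip Y.2) ∘L ContinuousLinearMap.snd ℝ ℍ[ℝ] E)) z := by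
  have h1 : HasFDerivAt (α i) (fderiv ℝ (α i) z.2) z.2 :=
    (((hV.smooth_form i).contDiffAt (hV.isOpen.mem_nhds hz.2)).differentiableAt
      (by simp)).hasFDerivAt
  have h2 := (h1.comp z hasFDerivAt_snd).clm_apply (hasFDerivAt_const (𝕜 := ℝ) Y.2 z)
  refine ((hasFDerivAt_const (quatIm i Y.1) z).sub (h2.const_mul ν)).congr_fderiv ?_
  ext <;> simp

/-- Since dα_i is the Kähler form Ω_i', d(θ_i/t) = -dt ∧ θ_i / t² - ν Ω_i' / t. Adding θ_{i+1} ∧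
θ_{i+2} / t² completes this to -ν times the Kähler form of the model. This identity fixes the
constant in the scalar curvature. -/
theorem HyperKahlerChart.extDerivForm_modelConnForm (hV : HyperKahlerChart V h A α) (hν : ν < 0)
    {z : ℍ[ℝ] × E} (hz : z ∈ halfDomain V) (i : Fin 3) (X Y : ℍ[ℝ] × E) :
    extDerivForm (modelConnForm ν α i) z X Y +
      (modelConnForm ν α (i + 1) z X * modelConnForm ν α (i + 2) z Y -
        modelConnForm ν α (i + 1) z Y * modelConnForm ν α (i + 2) z X) =
      -ν * modelMetricField ν h α z (modelEndField ν A α i z X) Y := by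
  have ht : z.1.re ≠ 0 := hz.1.ne'
  have hν' := hν.ne
  have hr : HasFDerivAt (fun z : ℍ[ℝ] × E => 1 / z.1.re) (-(1 / z.1.re ^ 2) • thetaRe E) z := by
    have := (hasDerivAt_inv ht).comp_hasFDerivAt z ((thetaRe E).hasFDerivAt (x := z))
    simpa [one_div, Function.comp_def, thetaRe_apply] using this
  have hd (X Y : ℍ[ℝ] × E) : fderiv ℝ (modelConnForm ν α i) z X Y =
      1 / z.1.re * (-ν * fderiv ℝ (α i) z.2 X.2 Y.2)
        + (-(1 / z.1.re ^ 2) * thetaRe E X) * thetaIm ν (fun i => α i z.2) i Y := by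
    have h1 : DifferentiableAt ℝ (modelConnForm ν α i) z :=
      hr.differentiableAt.smul ((hV.contDiffAt_thetaIm ν hz i).differentiableAt (by simp))
    have h2 := h1.hasFDerivAt.clm_apply (hasFDerivAt_const (𝕜 := ℝ) Y z)
    have h3 := hr.mul (hV.hasFDerivAt_thetaIm ν hz i Y)
    have := DFunLike.congr_fun (h2.unique h3) X
    simp only [add_apply, ContinuousLinearMap.comp_apply, map_zero,
      zero_apply, zero_add, ContinuousLinearMap.flip_apply,
      smul_apply, smul_eq_mul] at this
    rw [this]
    simp
    ring
  have hp := hV.primitive z.2 hz.2 i X.2 Y.2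
  obtain ⟨h1, h2, h3, h4⟩ := theta_modelEnd ν (fun i => α i z.2) i (A i z.2) X
  unfold extDerivForm at hp ⊢
  rw [hd, hd]
  simp only [modelConnForm, modelMetricField, modelEndField, modelMetric_apply,
    sum_fin_three_cyclic _ i, h1, h2, h3, h4, modelEnd_snd, smul_eq_mul, smul_apply, ← hp]
  field_simp
  ring

/-- The Christoffel symbols of the model. -/
def modelChristoffel (ν : ℝ) (h : E → E →L[ℝ] E →L[ℝ] ℝ) (A : Fin 3 → E → E →L[ℝ] E)
    (α : Fin 3 → E → E →L[ℝ] ℝ) (z X Y : ℍ[ℝ] × E) : ℍ[ℝ] × E :=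
  let θ := thetaIm ν (fun i => α i z.2)
  let τ := thetaRe E
  let t := z.1.re
  thetaVec ν (fun i => α i z.2)
    (-(1 / t) * (τ X * τ Y - ∑ i, θ i X * θ i Y) - ν / 2 * h z.2 X.2 Y.2)
    (fun i => -(1 / t) * (τ X * θ i Y + τ Y * θ i X) + ν / 2 * h z.2 (A i z.2 X.2) Y.2
      - ν * fderiv ℝ (α i) z.2 X.2 Y.2)
    (christoffel h z.2 X.2 Y.2 + (1 / (2 * t)) • (-(τ X • Y.2) - τ Y • X.2 +
      ∑ i, (θ i X • A i z.2 Y.2 + θ i Y • A i z.2 X.2)))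

theorem HyperKahlerChart.christoffel_symm [FiniteDimensional ℝ E]
    (hV : HyperKahlerChart V h A α) {y : E} (hy : y ∈ V) (X Y : E) :
    christoffel h y X Y = christoffel h y Y X :=
  HHqK.christoffel_symm (hV.posDef y hy)
    ((hV.smooth_metric.contDiffAt (hV.isOpen.mem_nhds hy)).differentiableAt (by simp))
    (Filter.Eventually.mono (hV.isOpen.mem_nhds hy : ∀ᶠ w in nhds y, w ∈ V) hV.symm) X Y

theorem HyperKahlerChart.fderiv_metric [FiniteDimensional ℝ E]
    (hV : HyperKahlerChart V h A α) {y : E} (hy : y ∈ V) (X Y Z : E) :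
    fderiv ℝ h y X Y Z = h y (christoffel h y X Y) Z + h y Y (christoffel h y X Z) :=
  christoffel_metric (hV.posDef y hy)
    ((hV.smooth_metric.contDiffAt (hV.isOpen.mem_nhds hy)).differentiableAt (by simp))
    (Filter.Eventually.mono (hV.isOpen.mem_nhds hy : ∀ᶠ w in nhds y, w ∈ V) hV.symm) X Y Z

theorem HyperKahlerChart.skew (hV : HyperKahlerChart V h A α) {y : E} (hy : y ∈ V) (i : Fin 3)
    (X Y : E) : h y (A i y X) Y = -h y X (A i y Y) :=
  (hV.triple y hy i).bilin_skew (hV.orth y hy i) X Y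

/-- Only the θ_i-component is not visibly symmetric. Its antisymmetric part is ν Ω_i' - ν dα_i,
which vanishes because α_i is a primitive. The term in ∂α_i is present because θ_i is not constant:
it cancels the derivative of θ_i(Y) in ∇θ_i. -/
theorem HyperKahlerChart.modelChristoffel_symm [FiniteDimensional ℝ E]
    (hV : HyperKahlerChart V h A α) (ν : ℝ)
    {z : ℍ[ℝ] × E} (hz : z ∈ halfDomain V) (X Y : ℍ[ℝ] × E) :
    modelChristoffel ν h A α z X Y = modelChristoffel ν h A α z Y X := by
  unfold modelChristoffel
  dsimp only
  congr 1
  · rw [hV.symm z.2 hz.2 X.2 Y.2]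
    simp only [mul_comm]
  · ext i
    have h1 := hV.primitive z.2 hz.2 i X.2 Y.2
    have h2 := hV.skew hz.2 i X.2 Y.2
    rw [hV.symm z.2 hz.2 X.2] at h2
    unfold extDerivForm at h1
    linear_combination (-ν) * h1 - ν / 2 * h2
  · rw [hV.christoffel_symm hz.2 X.2 Y.2]
    congr 2
    simp only [Fin.sum_univ_three]
    abel

theorem HyperKahlerChart.fderiv_modelMetricField [FiniteDimensional ℝ E]
    (hV : HyperKahlerChart V h A α) (hν : ν < 0)
    {z : ℍ[ℝ] × E} (hz : z ∈ halfDomain V) (X Y Z : ℍ[ℝ] × E) :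
    fderiv ℝ (modelMetricField ν h α) z X Y Z =
      2 / (ν * z.1.re ^ 3) * thetaRe E X * (thetaRe E Y * thetaRe E Z +
        ∑ i, thetaIm ν (fun i => α i z.2) i Y * thetaIm ν (fun i => α i z.2) i Z)
      + 1 / z.1.re ^ 2 * (∑ i, (fderiv ℝ (α i) z.2 X.2 Y.2 * thetaIm ν (fun i => α i z.2) i Z
        + thetaIm ν (fun i => α i z.2) i Y * fderiv ℝ (α i) z.2 X.2 Z.2))
      - 1 / z.1.re ^ 2 * thetaRe E X * h z.2 Y.2 Z.2
      + 1 / z.1.re * fderiv ℝ h z.2 X.2 Y.2 Z.2 := by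
  have ht : z.1.re ≠ 0 := hz.1.ne'
  have hν' := hν.ne
  have hτ : HasFDerivAt (fun z : ℍ[ℝ] × E => z.1.re) (thetaRe E) z := (thetaRe E).hasFDerivAt
  have hr : HasFDerivAt (fun z : ℍ[ℝ] × E => 1 / z.1.re) (-(1 / z.1.re ^ 2) • thetaRe E) z := by
    have := (hasDerivAt_inv ht).comp_hasFDerivAt z hτ
    simpa [one_div, Function.comp_def, thetaRe_apply] using this
  have hc : HasFDerivAt (fun z : ℍ[ℝ] × E => -(1 / (ν * z.1.re ^ 2)))
      ((2 / (ν * z.1.re ^ 3)) • thetaRe E) z := by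
    have := ((hr.pow 2).const_mul (-(1 / ν)))
    refine (this.congr_of_eventuallyEq (Filter.Eventually.of_forall fun w => ?_)).congr_fderiv ?_
    · simp [mul_comm]
    · ext X <;> simp <;> field_simp
  have hd : DifferentiableAt ℝ h z.2 :=
    (hV.smooth_metric.contDiffAt (hV.isOpen.mem_nhds hz.2)).differentiableAt (by simp)
  have hh := (((hd.hasFDerivAt.comp z hasFDerivAt_snd).clm_apply
    (hasFDerivAt_const (𝕜 := ℝ) Y.2 z)).clm_apply (hasFDerivAt_const (𝕜 := ℝ) Z.2 z))
  have h1 := (hV.contDiffAt_modelMetricField hν hz).differentiableAt (by simp)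
  have h2 := (h1.hasFDerivAt.clm_apply (hasFDerivAt_const (𝕜 := ℝ) Y z)).clm_apply
    (hasFDerivAt_const (𝕜 := ℝ) Z z)
  have hθ (i) := (hV.hasFDerivAt_thetaIm ν hz i Y).mul (hV.hasFDerivAt_thetaIm ν hz i Z)
  have h3 := (hc.mul ((HasFDerivAt.fun_sum (u := Finset.univ) fun i _ => hθ i).const_add
    (thetaRe E Y * thetaRe E Z))).add (hr.mul hh)
  have h4 := h3.congr_of_eventuallyEq (f₁ := fun z => modelMetricField ν h α z Y Z)
    (Filter.Eventually.of_forall fun w => modelMetric_apply _ _ _ _ _ _)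
  have := DFunLike.congr_fun (h2.unique h4) X
  simp only [add_apply, ContinuousLinearMap.comp_apply, map_zero,
      zero_apply, zero_add, ContinuousLinearMap.flip_apply,
      smul_apply, smul_eq_mul] at this
  rw [this]
  simp [Fin.sum_univ_three]
  field_simp
  ring

/-- Koszul uniqueness leaves only metricity to check. There the A_i-terms cancel by skewness, and
the derivative of h is expressed through its own Levi-Civita connection. -/
theorem HyperKahlerChart.christoffel_modelMetricField [FiniteDimensional ℝ E]
    (hV : HyperKahlerChart V h A α) (hν : ν < 0)
    {z : ℍ[ℝ] × E} (hz : z ∈ halfDomain V) (X Y : ℍ[ℝ] × E) :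
    christoffel (modelMetricField ν h α) z X Y = modelChristoffel ν h A α z X Y := by
  have ht : z.1.re ≠ 0 := hz.1.ne'
  have hν' := hν.ne
  refine christoffel_eq (modelMetric_posDef (hV.posDef _ hz.2) hν hz.1 _)
    (modelMetric_symm (hV.symm _ hz.2) _ _ _) (hV.modelChristoffel_symm ν hz) ?_ X Y
  intro X Y Z
  have s1 := hV.skew hz.2 0 Y.2 Z.2
  have s2 := hV.skew hz.2 1 Y.2 Z.2
  have s3 := hV.skew hz.2 2 Y.2 Z.2
  rw [hV.fderiv_modelMetricField hν hz, hV.fderiv_metric hz.2]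
  simp only [modelMetricField, modelMetric_apply, modelChristoffel, thetaRe_thetaVec,
    thetaIm_thetaVec, thetaVec_snd, Fin.sum_univ_three, map_add, map_sub, map_smul, map_neg,
    add_apply, sub_apply, smul_apply, neg_apply, smul_eq_mul, s1, s2, s3]
  rw [hV.symm z.2 hz.2 Y.2 X.2, hV.symm z.2 hz.2 Y.2 (A 0 z.2 X.2),
    hV.symm z.2 hz.2 Y.2 (A 1 z.2 X.2), hV.symm z.2 hz.2 Y.2 (A 2 z.2 X.2)]
  field_simp
  ring

end ModelGeometry

/-! ### The quaternionic Kähler structure of the model -/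

section ModelQuaternionic

variable {E : Type*} [NormedAddCommGroup E] [NormedSpace ℝ E]
  {V : Set E} {h : E → E →L[ℝ] E →L[ℝ] ℝ} {A : Fin 3 → E → E →L[ℝ] E}
  {α : Fin 3 → E → E →L[ℝ] ℝ} {ν : ℝ}

theorem theta_modelEndField (ν : ℝ) (A : Fin 3 → E → E →L[ℝ] E)
    (α : Fin 3 → E → E →L[ℝ] ℝ) (z : ℍ[ℝ] × E) (i : Fin 3) (X : ℍ[ℝ] × E) :
    thetaRe E (modelEndField ν A α i z X) = thetaIm ν (fun i => α i z.2) i X ∧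
    thetaIm ν (fun i => α i z.2) i (modelEndField ν A α i z X) = -thetaRe E X ∧
    thetaIm ν (fun i => α i z.2) (i + 1) (modelEndField ν A α i z X) =
      -thetaIm ν (fun i => α i z.2) (i + 2) X ∧
    thetaIm ν (fun i => α i z.2) (i + 2) (modelEndField ν A α i z X) =
      thetaIm ν (fun i => α i z.2) (i + 1) X :=
  theta_modelEnd ν (fun i => α i z.2) i (A i z.2) X

/-- Leibniz rule for the function θ_j(A_i Y): the form θ_j also varies with the point, through -ν
α_j, which accounts for the second term. -/
theorem HyperKahlerChart.thetaIm_fderiv_modelEndField (hV : HyperKahlerChart V h A α) (ν : ℝ)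
    {z : ℍ[ℝ] × E} (hz : z ∈ halfDomain V) (i : Fin 3) (X Y : ℍ[ℝ] × E) (j : Fin 3)
    {L : ℍ[ℝ] × E →L[ℝ] ℝ}
    (hL : HasFDerivAt (fun w : ℍ[ℝ] × E =>
      thetaIm ν (fun i => α i w.2) j (modelEndField ν A α i w Y)) L z) :
    thetaIm ν (fun i => α i z.2) j (fderiv ℝ (modelEndField ν A α i) z X Y) =
      L X + ν * fderiv ℝ (α j) z.2 X.2 (A i z.2 Y.2) := by
  have hI := (((hV.contDiffAt_modelEndField ν hz i).differentiableAt
    (by simp)).hasFDerivAt).clm_apply (hasFDerivAt_const (𝕜 := ℝ) Y z)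
  have hθ (j : Fin 3) := ((hV.contDiffAt_thetaIm ν hz j).differentiableAt (by simp)).hasFDerivAt
  have hθ' (j : Fin 3) (W : ℍ[ℝ] × E) :
      fderiv ℝ (fun z : ℍ[ℝ] × E => thetaIm ν (fun i => α i z.2) j) z X W =
      -ν * fderiv ℝ (α j) z.2 X.2 W.2 := by
    have := DFunLike.congr_fun (((hθ j).clm_apply (hasFDerivAt_const (𝕜 := ℝ) W z)).unique
      (hV.hasFDerivAt_thetaIm ν hz j W)) X
    simpa using this
  have h1 := DFunLike.congr_fun (((hθ j).clm_apply hI).unique hL) X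
  simp only [add_apply, ContinuousLinearMap.comp_apply, map_zero, zero_add, zero_apply,
    ContinuousLinearMap.flip_apply, hθ'] at h1
  have h2 : (modelEndField ν A α i z Y).2 = A i z.2 Y.2 := rfl
  rw [h2] at h1
  linear_combination h1

theorem HyperKahlerChart.theta_fderiv_modelEndField (hV : HyperKahlerChart V h A α) (ν : ℝ)
    {z : ℍ[ℝ] × E} (hz : z ∈ halfDomain V) (i : Fin 3) (X Y : ℍ[ℝ] × E) :
    thetaRe E (fderiv ℝ (modelEndField ν A α i) z X Y) =
      -ν * fderiv ℝ (α i) z.2 X.2 Y.2 ∧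
    thetaIm ν (fun i => α i z.2) i (fderiv ℝ (modelEndField ν A α i) z X Y) =
      ν * fderiv ℝ (α i) z.2 X.2 (A i z.2 Y.2) ∧
    thetaIm ν (fun i => α i z.2) (i + 1) (fderiv ℝ (modelEndField ν A α i) z X Y) =
      ν * fderiv ℝ (α (i + 1)) z.2 X.2 (A i z.2 Y.2) + ν * fderiv ℝ (α (i + 2)) z.2 X.2 Y.2 ∧
    thetaIm ν (fun i => α i z.2) (i + 2) (fderiv ℝ (modelEndField ν A α i) z X Y) =
      ν * fderiv ℝ (α (i + 2)) z.2 X.2 (A i z.2 Y.2) - ν * fderiv ℝ (α (i + 1)) z.2 X.2 Y.2 ∧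
    (fderiv ℝ (modelEndField ν A α i) z X Y).2 = fderiv ℝ (A i) z.2 X.2 Y.2 := by
  have hI := (((hV.contDiffAt_modelEndField ν hz i).differentiableAt
    (by simp)).hasFDerivAt).clm_apply (hasFDerivAt_const (𝕜 := ℝ) Y z)
  have key := hV.thetaIm_fderiv_modelEndField ν hz i X Y
  have hw (w : ℍ[ℝ] × E) := theta_modelEndField ν A α w i Y
  refine ⟨?_, ?_, ?_, ?_, ?_⟩
  · have h1 := (thetaRe E).hasFDerivAt (x := modelEndField ν A α i z Y) |>.comp z hI
    have e : (thetaRe E ∘ fun w => modelEndField ν A α i w Y) =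
        fun w => thetaIm ν (fun i => α i w.2) i Y := funext fun w => (hw w).1
    rw [e] at h1
    have h2 := DFunLike.congr_fun (h1.unique (hV.hasFDerivAt_thetaIm ν hz i Y)) X
    simpa using h2
  · have h1 := hasFDerivAt_const (𝕜 := ℝ) (-thetaRe E Y) z
    rw [← funext fun w => (hw w).2.1] at h1
    rw [key i h1]
    simp
  · have h1 := (hV.hasFDerivAt_thetaIm ν hz (i + 2) Y).fun_neg
    rw [← funext fun w => (hw w).2.2.1] at h1
    rw [key (i + 1) h1]
    simp
    ring
  · have h1 := (hV.hasFDerivAt_thetaIm ν hz (i + 1) Y)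
    rw [← funext fun w => (hw w).2.2.2] at h1
    rw [key (i + 2) h1]
    simp
    ring
  · have hA : HasFDerivAt (A i) (fderiv ℝ (A i) z.2) z.2 :=
      (((hV.smooth_end i).contDiffAt (hV.isOpen.mem_nhds hz.2)).differentiableAt
        (by simp)).hasFDerivAt
    have h1 := (hA.comp z hasFDerivAt_snd).clm_apply (hasFDerivAt_const (𝕜 := ℝ) Y.2 z)
    have h2 := (ContinuousLinearMap.snd ℝ ℍ[ℝ] E).hasFDerivAt
      (x := modelEndField ν A α i z Y) |>.comp z hI
    have e : (ContinuousLinearMap.snd ℝ ℍ[ℝ] E ∘ fun w => modelEndField ν A α i w Y) =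
        fun w => A i w.2 Y.2 := rfl
    rw [e] at h2
    have h3 := DFunLike.congr_fun (h2.unique h1) X
    simpa using h3

/-- Compared component by component in the coframe. The derivatives of the α_j in ∂A_i cancel those
in the Christoffel symbols, and the E-component uses that A_i' is parallel; the remaining terms are
products of θ's with the quaternion relations. -/
theorem HyperKahlerChart.nablaEnd_modelEndField [FiniteDimensional ℝ E]
    (hV : HyperKahlerChart V h A α) (hν : ν < 0)
    {z : ℍ[ℝ] × E} (hz : z ∈ halfDomain V) (i : Fin 3) (X : ℍ[ℝ] × E) :
    nablaEnd (modelMetricField ν h α) (modelEndField ν A α i) z X =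
      modelConnForm ν α (i + 2) z X • modelEndField ν A α (i + 1) z -
        modelConnForm ν α (i + 1) z X • modelEndField ν A α (i + 2) z := by
  refine ContinuousLinearMap.ext fun Y => ?_
  -- Naming 1/(2t) keeps the identities below polynomial, so that `ring` and `module` apply.
  obtain ⟨u, hu⟩ : ∃ u, u = 1 / (2 * z.1.re) := ⟨_, rfl⟩
  have hu' : 1 / z.1.re = 2 * u := by rw [hu]; field_simp
  have ht := hV.triple z.2 hz.2 i
  have s0 := hV.skew hz.2 i
  have s1 := hV.skew hz.2 (i + 1)
  have s2 := hV.skew hz.2 (i + 2)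
  obtain ⟨f1, f2, f3, f4⟩ := fin_three_add i
  obtain ⟨d0, d1, d2, d3, d4⟩ := hV.theta_fderiv_modelEndField ν hz i X Y
  obtain ⟨a0, a1, a2, a3⟩ := theta_modelEnd ν (fun i => α i z.2) i (A i z.2) Y
  obtain ⟨b0, b1, b2, b3⟩ := theta_modelEnd ν (fun i => α i z.2) (i + 1) (A (i + 1) z.2) Y
  obtain ⟨c0, c1, c2, c3⟩ := theta_modelEnd ν (fun i => α i z.2) (i + 2) (A (i + 2) z.2) Y
  obtain ⟨g0, g1, g2, g3⟩ := theta_modelEnd ν (fun i => α i z.2) i (A i z.2)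
    (modelChristoffel ν h A α z X Y)
  have hp := DFunLike.congr_fun (DFunLike.congr_fun (hV.parallel z.2 hz.2 i) X.2) Y.2
  rw [nablaEnd_apply] at hp
  simp only [zero_apply] at hp
  simp only [f1, f2, f3, f4] at b0 b1 b2 b3 c0 c1 c2 c3
  rw [nablaEnd_apply, hV.christoffel_modelMetricField hν hz,
    hV.christoffel_modelMetricField hν hz]
  simp only [sub_apply, smul_apply]
  refine theta_ext (ν := ν) (β := fun i => α i z.2) ?_ (forall_fin_three_cyclic i ?_ ?_ ?_) ?_
  · simp only [map_add, map_sub, map_smul, smul_eq_mul, d0]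
    simp only [modelEndField, g0, b0, c0]
    simp only [modelChristoffel, thetaRe_thetaVec, thetaIm_thetaVec, modelConnForm, smul_apply,
      smul_eq_mul, sum_fin_three_cyclic _ i, a0, a1, a2, a3, modelEnd_snd, s0, hu']
    ring
  · simp only [map_add, map_sub, map_smul, smul_eq_mul, d1]
    simp only [modelEndField, g1, b3, c2]
    simp only [modelChristoffel, thetaRe_thetaVec, thetaIm_thetaVec, modelConnForm, smul_apply,
      smul_eq_mul, sum_fin_three_cyclic _ i, a0, a1, a2, a3, modelEnd_snd, s0, ht.AA, map_neg, hu']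
    ring
  · simp only [map_add, map_sub, map_smul, smul_eq_mul, d2]
    simp only [modelEndField, g2, b1, c3]
    simp only [modelChristoffel, thetaIm_thetaVec, modelConnForm, smul_apply,
      smul_eq_mul, sum_fin_three_cyclic _ i, a0, a1, a2, a3, modelEnd_snd, s1, s2, ht.BA, map_neg,
      hu']
    ring
  · simp only [map_add, map_sub, map_smul, smul_eq_mul, d3]
    simp only [modelEndField, g3, b2, c1]
    simp only [modelChristoffel, thetaIm_thetaVec, modelConnForm, smul_apply,
      smul_eq_mul, sum_fin_three_cyclic _ i, a0, a1, a2, a3, modelEnd_snd, s1, s2, ht.CA, hu']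
    ring
  · simp only [Prod.snd_add, Prod.snd_sub, Prod.smul_snd, d4]
    simp only [modelEndField, modelEnd_snd, modelChristoffel, thetaVec_snd, modelConnForm,
      smul_apply, smul_eq_mul, sum_fin_three_cyclic _ i, a0, a1, a2, a3, ht.AA, ht.AB, ht.AC,
      ht.BA, ht.CA, map_add, map_sub, map_smul, map_neg, hu', ← hu]
    rw [sub_eq_zero] at hp
    have hp' := eq_sub_of_add_eq hp
    rw [hp']
    module

theorem HyperKahlerChart.triple_modelEndField (hV : HyperKahlerChart V h A α) (ν : ℝ)
    {z : ℍ[ℝ] × E} (hz : z ∈ halfDomain V) (i : Fin 3) :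
    IsQuaternionicTriple (modelEndField ν A α i z) (modelEndField ν A α (i + 1) z)
      (modelEndField ν A α (i + 2) z) :=
  have hsq (j : Fin 3) := modelEnd_sq (hV.triple z.2 hz.2 j).AA ν (fun i => α i z.2) j
  IsQuaternionicTriple.of_mul (hsq i) (hsq (i + 1)) (hsq (i + 2)) fun X => by
    have := modelEnd_mul (hV.triple z.2 hz.2 i).AB ν (fun i => α i z.2) i
      (modelEndField ν A α (i + 2) z X)
    exact this.trans (hsq (i + 2) X)

/-- The scalar curvature of the model. -/
theorem HyperKahlerChart.scalarCurvature_modelMetricField [FiniteDimensional ℝ E]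
    (hV : HyperKahlerChart V h A α) (hν : ν < 0) {z : ℍ[ℝ] × E} (hz : z ∈ halfDomain V) :
    scalarCurvature (modelMetricField ν h α) z =
      ν * (Module.finrank ℝ (ℍ[ℝ] × E) * (Module.finrank ℝ (ℍ[ℝ] × E) + 8)) / 4 := by
  have hd (i : Fin 3) : DifferentiableAt ℝ (modelConnForm ν α i) z := by
    have h1 : ContDiffAt ℝ ∞ (fun z : ℍ[ℝ] × E => 1 / z.1.re) z :=
      contDiffAt_const.div (contDiffAt_re z) hz.1.ne'
    exact (h1.smul (hV.contDiffAt_thetaIm ν hz i)).differentiableAt (by simp)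
  have := scalarCurvature_of_frame (g := modelMetricField ν h α) (A := modelEndField ν A α 0)
    (B := modelEndField ν A α 1) (C := modelEndField ν A α 2) (a := modelConnForm ν α 0)
    (b := modelConnForm ν α 1) (c := modelConnForm ν α 2) (lam := -ν)
    (isOpen_halfDomain hV.isOpen) hz
    (fun w hw => hV.contDiffAt_modelMetricField hν hw)
    (fun w hw => modelMetric_posDef (hV.posDef _ hw.2) hν hw.1 _)
    (fun w hw => modelMetric_symm (hV.symm _ hw.2) _ _ _)
    (hV.contDiffAt_modelEndField ν hz 0) (hV.contDiffAt_modelEndField ν hz 1)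
    (hV.contDiffAt_modelEndField ν hz 2) (hd 0) (hd 1) (hd 2)
    (hV.triple_modelEndField ν hz 0)
    (modelMetric_orth (hV.orth _ hz.2 0) _ _ _ 0)
    (fun w hw => hV.nablaEnd_modelEndField hν hw 0)
    (fun w hw => hV.nablaEnd_modelEndField hν hw 1)
    (fun w hw => hV.nablaEnd_modelEndField hν hw 2)
    (hV.extDerivForm_modelConnForm hν hz 0)
    (hV.extDerivForm_modelConnForm hν hz 1)
    (hV.extDerivForm_modelConnForm hν hz 2)
  rw [this]
  ring

/-- These two relations between the connection forms are exactly what integrability of A_i requires.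
-/
theorem modelConnForm_modelEndField (ν : ℝ) (A : Fin 3 → E → E →L[ℝ] E)
    (α : Fin 3 → E → E →L[ℝ] ℝ) (z : ℍ[ℝ] × E) (i : Fin 3) (X : ℍ[ℝ] × E) :
    modelConnForm ν α (i + 2) z (modelEndField ν A α i z X) = modelConnForm ν α (i + 1) z X ∧
    modelConnForm ν α (i + 1) z (modelEndField ν A α i z X) = -modelConnForm ν α (i + 2) z X := by
  obtain ⟨a0, a1, a2, a3⟩ := theta_modelEnd ν (fun i => α i z.2) i (A i z.2) X
  simp [modelConnForm, modelEndField, a2, a3]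

/-- The connection forms satisfy ∇_{AX} A = A ∘ ∇_X A, so the four terms of `nijenhuis_eq` cancel in
pairs. -/
theorem HyperKahlerChart.nijenhuis_modelEndField [FiniteDimensional ℝ E]
    (hV : HyperKahlerChart V h A α) (hν : ν < 0) {z : ℍ[ℝ] × E} (hz : z ∈ halfDomain V)
    (i : Fin 3) (X Y : ℍ[ℝ] × E) : nijenhuis (modelEndField ν A α i) z X Y = 0 := by
  have hs (X Y : ℍ[ℝ] × E) : christoffel (modelMetricField ν h α) z X Y =
      christoffel (modelMetricField ν h α) z Y X := by
    rw [hV.christoffel_modelMetricField hν hz, hV.christoffel_modelMetricField hν hz,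
      hV.modelChristoffel_symm ν hz]
  have hc := modelConnForm_modelEndField ν A α z i
  have ht := hV.triple_modelEndField ν hz i
  rw [nijenhuis_eq hs]
  simp only [hV.nablaEnd_modelEndField hν hz, sub_apply, smul_apply, map_sub, map_smul,
    (hc _).1, (hc _).2, ht.AB, ht.AC]
  module

/-- A_i ∘ (∇A_i)Y is a sum of two rank one maps with traces a_j(A_j Y), j = i+1, i+2. Each equals
-dt(Y)/t because θ_j ∘ A_j = -dt, so the result does not depend on i. -/
theorem HyperKahlerChart.leeForm_modelEndField [FiniteDimensional ℝ E]
    (hV : HyperKahlerChart V h A α) (hν : ν < 0) {z : ℍ[ℝ] × E} (hz : z ∈ halfDomain V)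
    (i : Fin 3) (Y : ℍ[ℝ] × E) :
    leeForm (modelMetricField ν h α) (modelEndField ν A α i) z Y =
      -(1 / z.1.re * thetaRe E Y) := by
  have ht := hV.triple_modelEndField ν hz i
  have e : (modelEndField ν A α i z ∘L (nablaEnd (modelMetricField ν h α)
      (modelEndField ν A α i) z).flip Y).toLinearMap =
      (modelConnForm ν α (i + 2) z).toLinearMap.smulRight (modelEndField ν A α (i + 2) z Y) +
      (modelConnForm ν α (i + 1) z).toLinearMap.smulRight (modelEndField ν A α (i + 1) z Y) := by
    refine LinearMap.ext fun X => ?_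
    simp [hV.nablaEnd_modelEndField hν hz, ht.AB, ht.AC]
  have b1 := (theta_modelEnd ν (fun i => α i z.2) (i + 1) (A (i + 1) z.2) Y).2.1
  have b2 := (theta_modelEnd ν (fun i => α i z.2) (i + 2) (A (i + 2) z.2) Y).2.1
  rw [leeForm, e, map_add, LinearMap.trace_smulRight, LinearMap.trace_smulRight]
  simp only [modelConnForm, modelEndField, ContinuousLinearMap.coe_coe, smul_apply, smul_eq_mul,
    b1, b2]
  ring

end ModelQuaternionic

/-! ### Coordinate expressions in charts -/

section Charts

theorem IsQuaternionicTriple.rotate {F : Type*} [NormedAddCommGroup F] [NormedSpace ℝ F]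
    {A B C : F →L[ℝ] F} (h : IsQuaternionicTriple A B C) : IsQuaternionicTriple B C A :=
  ⟨h.BB, h.CC, h.AA, h.BC, h.CB, h.CA, h.AC, h.AB, h.BA⟩

theorem IsQuaternionicTriple.conj {F : Type*} [NormedAddCommGroup F] [NormedSpace ℝ F]
    {A B C P Q : F →L[ℝ] F} (h : IsQuaternionicTriple A B C) (hPQ : ∀ X, P (Q X) = X)
    (hQP : ∀ X, Q (P X) = X) :
    IsQuaternionicTriple (Q ∘L A ∘L P) (Q ∘L B ∘L P) (Q ∘L C ∘L P) := by
  constructor <;> intro X <;>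
    simp [hPQ, hQP, h.AA, h.BB, h.CC, h.AB, h.BA, h.BC, h.CB, h.CA, h.AC]

theorem orthogonal_conj {F : Type*} [NormedAddCommGroup F] [NormedSpace ℝ F]
    {b : F →L[ℝ] F →L[ℝ] ℝ} {A P Q : F →L[ℝ] F} (hA : ∀ X Y, b (A X) (A Y) = b X Y)
    (hPQ : ∀ X, P (Q X) = X) (X Y : F) :
    b (P (Q (A (P X)))) (P (Q (A (P Y)))) = b (P X) (P Y) := by
  rw [hPQ, hPQ, hA]

variable {E : Type*} [NormedAddCommGroup E] [NormedSpace ℝ E]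
  {M' : Type*} [TopologicalSpace M'] [ChartedSpace E M']

/-- The differential of the inverse of a chart. -/
def chartInv (e : OpenPartialHomeomorph M' E) (y : E) : E →L[ℝ] E :=
  mfderiv 𝓘(ℝ, E) 𝓘(ℝ, E) (e.extend 𝓘(ℝ, E)).symm y

/-- The differential of a chart. -/
def chartDiff (e : OpenPartialHomeomorph M' E) (x : M') : E →L[ℝ] E :=
  mfderiv 𝓘(ℝ, E) 𝓘(ℝ, E) (e.extend 𝓘(ℝ, E)) x

omit [ChartedSpace E M'] in
theorem mem_extend_target {e : OpenPartialHomeomorph M' E} {y : E} :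
    y ∈ (e.extend 𝓘(ℝ, E)).target ↔ y ∈ e.target := by simp

theorem IsHyperKahler.triple {g' : BilinField 𝓘(ℝ, E) M'} {I' J' K' : EndField 𝓘(ℝ, E) M'}
    (hM' : IsHyperKahler g' I' J' K') (x : M') :
    IsQuaternionicTriple (F := E) (I' x) (J' x) (K' x) :=
  have h := hM'.almostHyperHermitian.hypercomplex
  IsQuaternionicTriple.of_mul (F := E) (A := I' x) (B := J' x) (C := K' x)
    (h.I_sq x) (h.J_sq x) (h.K_sq x) (h.IJK x)

variable [IsManifold 𝓘(ℝ, E) ∞ M']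

theorem chartDiff_chartInv {e : OpenPartialHomeomorph M' E} (he : e ∈ atlas E M') {y : E}
    (hy : y ∈ (e.extend 𝓘(ℝ, E)).target) (X : E) :
    chartDiff e (e.symm y) (chartInv e y X) = X :=
  DFunLike.congr_fun ((mdifferentiable_of_mem_atlas (I := 𝓘(ℝ, E)) he).comp_symm_deriv
    (mem_extend_target.1 hy)) X

theorem chartInv_chartDiff {e : OpenPartialHomeomorph M' E} (he : e ∈ atlas E M') {y : E}
    (hy : y ∈ (e.extend 𝓘(ℝ, E)).target) (X : E) :
    chartInv e y (chartDiff e (e.symm y) X) = X := by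
  have hy' := mem_extend_target.1 hy
  have h := DFunLike.congr_fun ((mdifferentiable_of_mem_atlas (I := 𝓘(ℝ, E)) he).symm_comp_deriv
    (e.map_target hy')) X
  rw [e.right_inv hy'] at h
  exact h

theorem chartBilin_chartEnd_of_isOrthogonal {g' : BilinField 𝓘(ℝ, E) M'}
    {A : EndField 𝓘(ℝ, E) M'} (hA : IsOrthogonal g' A) {e : OpenPartialHomeomorph M' E}
    (he : e ∈ atlas E M') {y : E} (hy : y ∈ (e.extend 𝓘(ℝ, E)).target) (X Y : E) :
    chartBilin e g' y (chartEnd e A y X) (chartEnd e A y Y) = chartBilin e g' y X Y :=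
  orthogonal_conj (F := E) (b := g' (e.symm y)) (A := A (e.symm y)) (P := chartInv e y)
    (Q := chartDiff e (e.symm y)) (hA (e.symm y)) (chartInv_chartDiff he hy) X Y

theorem chartBilin_posDef {g' : BilinField 𝓘(ℝ, E) M'} (hg : IsRiemannianMetric g')
    {e : OpenPartialHomeomorph M' E} (he : e ∈ atlas E M') {y : E}
    (hy : y ∈ (e.extend 𝓘(ℝ, E)).target) : PosDefForm (chartBilin e g' y) := by
  intro X hX
  refine hg.pos _ _ fun h => hX ?_
  have h1 := chartDiff_chartInv he hy X
  have h2 : chartInv e y X = 0 := h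
  rw [h2, map_zero] at h1
  exact h1.symm

theorem IsHyperKahler.chartEnd_triple {g' : BilinField 𝓘(ℝ, E) M'}
    {I' J' K' : EndField 𝓘(ℝ, E) M'} (hM' : IsHyperKahler g' I' J' K')
    {e : OpenPartialHomeomorph M' E} (he : e ∈ atlas E M') {y : E}
    (hy : y ∈ (e.extend 𝓘(ℝ, E)).target) :
    IsQuaternionicTriple (chartEnd e I' y) (chartEnd e J' y) (chartEnd e K' y) :=
  (hM'.triple (e.symm y)).conj (P := chartInv e y) (Q := chartDiff e (e.symm y))
    (chartInv_chartDiff he hy) (chartDiff_chartInv he hy)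

/-- Passage to coordinates: algebraic identities survive conjugation by the differential of the
chart, and the differential conditions are chartwise by definition. -/
theorem IsHyperKahler.hyperKahlerChart {g' : BilinField 𝓘(ℝ, E) M'}
    {I' J' K' : EndField 𝓘(ℝ, E) M'} (hM' : IsHyperKahler g' I' J' K')
    {αI αJ αK : FormField 𝓘(ℝ, E) M'}
    (hαI : SmoothForm αI) (hαJ : SmoothForm αJ) (hαK : SmoothForm αK)
    (hdI : IsPrimitiveOfKahlerForm g' I' αI) (hdJ : IsPrimitiveOfKahlerForm g' J' αJ)
    (hdK : IsPrimitiveOfKahlerForm g' K' αK)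
    {e : OpenPartialHomeomorph M' E} (he : e ∈ atlas E M') :
    HyperKahlerChart (e.extend 𝓘(ℝ, E)).target (chartBilin e g')
      ![chartEnd e I', chartEnd e J', chartEnd e K']
      ![chartForm e αI, chartForm e αJ, chartForm e αK] := by
  have h := hM'.almostHyperHermitian
  have ht (y) (hy) := hM'.chartEnd_triple he (y := y) hy
  refine ⟨e.isOpen_extend_target, h.metric.smooth e he,
    forall_fin_three_cyclic 0 (h.hypercomplex.smooth_I e he) (h.hypercomplex.smooth_J e he)
      (h.hypercomplex.smooth_K e he),
    forall_fin_three_cyclic 0 (hαI e he) (hαJ e he) (hαK e he),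
    fun y _ X Y => h.metric.symm _ _ _, fun y hy => chartBilin_posDef h.metric he hy,
    fun y hy => forall_fin_three_cyclic 0 (ht y hy) (ht y hy).rotate (ht y hy).rotate.rotate,
    fun y hy => forall_fin_three_cyclic 0 (chartBilin_chartEnd_of_isOrthogonal h.orth_I he hy)
      (chartBilin_chartEnd_of_isOrthogonal h.orth_J he hy)
      (chartBilin_chartEnd_of_isOrthogonal h.orth_K he hy),
    fun y hy => forall_fin_three_cyclic 0 (hM'.parallel_I e he y hy) (hM'.parallel_J e he y hy)
      (hM'.parallel_K e he y hy),
    fun y hy => forall_fin_three_cyclic 0 (hdI e he y hy) (hdJ e he y hy) (hdK e he y hy)⟩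

end Charts

/-! ### Charts of the half-space -/

section HalfSpaceCharts

/-- The atlas of an open subset of ℍ consists of restrictions of the identity chart. -/
theorem coe_eq_of_mem_atlas_halfSpace {e : OpenPartialHomeomorph halfSpace ℍ[ℝ]}
    (he : e ∈ atlas ℍ[ℝ] halfSpace) (q : halfSpace) : e q = (q : ℍ[ℝ]) := by
  obtain ⟨_, ⟨x, rfl⟩, h⟩ := he
  rw [Set.mem_singleton_iff] at h
  subst h
  rfl

theorem source_of_mem_atlas_halfSpace {e : OpenPartialHomeomorph halfSpace ℍ[ℝ]}
    (he : e ∈ atlas ℍ[ℝ] halfSpace) : e.source = Set.univ := by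
  obtain ⟨_, ⟨x, rfl⟩, h⟩ := he
  rw [Set.mem_singleton_iff] at h
  subst h
  simp [chartAt_self_eq]

theorem target_of_mem_atlas_halfSpace {e : OpenPartialHomeomorph halfSpace ℍ[ℝ]}
    (he : e ∈ atlas ℍ[ℝ] halfSpace) : e.target = {q | 0 < q.re} := by
  rw [← e.image_source_eq_target, source_of_mem_atlas_halfSpace he, Set.image_univ]
  ext q
  constructor
  · rintro ⟨p, rfl⟩
    rw [coe_eq_of_mem_atlas_halfSpace he]
    exact p.2
  · intro hq
    exact ⟨⟨q, hq⟩, coe_eq_of_mem_atlas_halfSpace he _⟩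

theorem coe_symm_of_mem_atlas_halfSpace {e : OpenPartialHomeomorph halfSpace ℍ[ℝ]}
    (he : e ∈ atlas ℍ[ℝ] halfSpace) {q : ℍ[ℝ]} (hq : 0 < q.re) : (e.symm q : ℍ[ℝ]) = q := by
  rw [← coe_eq_of_mem_atlas_halfSpace he]
  exact e.right_inv (by rw [target_of_mem_atlas_halfSpace he]; exact hq)

theorem hasMFDerivAt_coe_halfSpace (q : halfSpace) :
    HasMFDerivAt 𝓘(ℝ, ℍ[ℝ]) 𝓘(ℝ, ℍ[ℝ]) (fun q : halfSpace => (q : ℍ[ℝ])) q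
      (ContinuousLinearMap.id ℝ ℍ[ℝ]) := by
  refine ⟨continuous_subtype_val.continuousAt, ?_⟩
  have hc := chart_mem_atlas ℍ[ℝ] q
  have h0 : chartAt ℍ[ℝ] q q = (q : ℍ[ℝ]) := coe_eq_of_mem_atlas_halfSpace hc q
  refine HasFDerivAt.hasFDerivWithinAt ?_
  refine (hasFDerivAt_id _).congr_of_eventuallyEq ?_
  have h1 : ∀ᶠ y : ℍ[ℝ] in nhds (q : ℍ[ℝ]), 0 < y.re :=
    (isOpen_lt continuous_const Quaternion.continuous_re).mem_nhds q.2
  have h2 : extChartAt 𝓘(ℝ, ℍ[ℝ]) q q = (q : ℍ[ℝ]) := h0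
  rw [h2]
  filter_upwards [h1] with y hy
  exact coe_symm_of_mem_atlas_halfSpace hc hy

theorem hasMFDerivAt_symm_of_mem_atlas_halfSpace {e : OpenPartialHomeomorph halfSpace ℍ[ℝ]}
    (he : e ∈ atlas ℍ[ℝ] halfSpace) {q : ℍ[ℝ]} (hq : 0 < q.re) :
    HasMFDerivAt 𝓘(ℝ, ℍ[ℝ]) 𝓘(ℝ, ℍ[ℝ]) e.symm q (ContinuousLinearMap.id ℝ ℍ[ℝ]) := by
  have hm := mdifferentiable_of_mem_atlas (I := 𝓘(ℝ, ℍ[ℝ])) he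
  have ht : q ∈ e.target := by rw [target_of_mem_atlas_halfSpace he]; exact hq
  have h1 := hm.comp_symm_deriv ht
  have h2 : (e : halfSpace → ℍ[ℝ]) = fun q : halfSpace => (q : ℍ[ℝ]) :=
    funext (coe_eq_of_mem_atlas_halfSpace he)
  have h3 : mfderiv 𝓘(ℝ, ℍ[ℝ]) 𝓘(ℝ, ℍ[ℝ]) e (e.symm q) = ContinuousLinearMap.id ℝ ℍ[ℝ] := by
    rw [h2]
    exact (hasMFDerivAt_coe_halfSpace _).mfderiv
  have h4 := (hm.mdifferentiableAt_symm ht).hasMFDerivAt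
  have h5 : mfderiv 𝓘(ℝ, ℍ[ℝ]) 𝓘(ℝ, ℍ[ℝ]) e.symm q = ContinuousLinearMap.id ℝ ℍ[ℝ] := by
    refine ContinuousLinearMap.ext fun X => ?_
    have := DFunLike.congr_fun h1 X
    have h6 := DFunLike.congr_fun h3 (mfderiv 𝓘(ℝ, ℍ[ℝ]) 𝓘(ℝ, ℍ[ℝ]) e.symm q X)
    exact h6.symm.trans this
  rw [h5] at h4
  exact h4

end HalfSpaceCharts

/-! ### Product charts and basic forms on the product -/

section ProductCharts

variable {E : Type*} [NormedAddCommGroup E] [NormedSpace ℝ E]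
  {M' : Type*} [TopologicalSpace M'] [ChartedSpace E M']

omit [ChartedSpace E M'] in
theorem extend_prod_target {e₁ : OpenPartialHomeomorph halfSpace ℍ[ℝ]}
    (he₁ : e₁ ∈ atlas ℍ[ℝ] halfSpace) (e : OpenPartialHomeomorph M' E) :
    ((e₁.prod e).extend (prodModel E)).target = halfDomain (e.extend 𝓘(ℝ, E)).target := by
  ext z
  rw [OpenPartialHomeomorph.extend_prod]
  simp [halfDomain, target_of_mem_atlas_halfSpace he₁]

theorem differential_linear (L : ℍ[ℝ] →L[ℝ] ℝ) :
    differential (E := E) (M' := M') (fun p => L (p.1 : ℍ[ℝ])) =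
      fun _ => L ∘L ContinuousLinearMap.fst ℝ ℍ[ℝ] E := by
  funext p
  have h1 := (hasMFDerivAt_coe_halfSpace p.1).comp p
    (hasMFDerivAt_fst (I := 𝓘(ℝ, ℍ[ℝ])) (I' := 𝓘(ℝ, E)) p)
  exact ((L.hasFDerivAt (x := (p.1 : ℍ[ℝ]))).hasMFDerivAt.comp p h1).mfderiv

theorem dt_eq : dt E M' = fun _ => thetaRe E := differential_linear quatRe

theorem du_eq : du E M' = fun _ => quatIm 0 ∘L ContinuousLinearMap.fst ℝ ℍ[ℝ] E :=
  differential_linear (quatIm 0)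

theorem dv_eq : dv E M' = fun _ => quatIm 1 ∘L ContinuousLinearMap.fst ℝ ℍ[ℝ] E :=
  differential_linear (quatIm 1)

theorem dw_eq : dw E M' = fun _ => quatIm 2 ∘L ContinuousLinearMap.fst ℝ ℍ[ℝ] E :=
  differential_linear (quatIm 2)

theorem differential_log_re :
    differential (E := E) (M' := M') (fun p => Real.log (p.1 : ℍ[ℝ]).re) =
      fun p => (1 / (p.1 : ℍ[ℝ]).re) • thetaRe E := by
  funext p
  have h1 := (hasMFDerivAt_coe_halfSpace p.1).comp p
    (hasMFDerivAt_fst (I := 𝓘(ℝ, ℍ[ℝ])) (I' := 𝓘(ℝ, E)) p)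
  have h2 : HasFDerivAt (fun q : ℍ[ℝ] => Real.log q.re)
      ((1 / (p.1 : ℍ[ℝ]).re) • quatRe) (p.1 : ℍ[ℝ]) := by
    rw [one_div]
    exact (Real.hasDerivAt_log (ne_of_gt p.1.2)).comp_hasFDerivAt (p.1 : ℍ[ℝ])
      (quatRe.hasFDerivAt (x := (p.1 : ℍ[ℝ])))
  exact (h2.hasMFDerivAt.comp p h1).mfderiv

theorem pullForm_eq (β : FormField 𝓘(ℝ, E) M') :
    pullForm β = fun p => (show E →L[ℝ] ℝ from β p.2) ∘L ContinuousLinearMap.snd ℝ ℍ[ℝ] E := by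
  funext p
  rw [pullForm, mfderiv_snd]
  rfl

theorem pullBilin_eq (g : BilinField 𝓘(ℝ, E) M') :
    pullBilin g = fun p => (show E →L[ℝ] E →L[ℝ] ℝ from g p.2).bilinearComp
      (ContinuousLinearMap.snd ℝ ℍ[ℝ] E) (ContinuousLinearMap.snd ℝ ℍ[ℝ] E) := by
  funext p
  rw [pullBilin, mfderiv_snd]
  rfl

variable [IsManifold 𝓘(ℝ, E) ∞ M']

theorem mfderiv_prod_symm {e₁ : OpenPartialHomeomorph halfSpace ℍ[ℝ]}
    (he₁ : e₁ ∈ atlas ℍ[ℝ] halfSpace) {e : OpenPartialHomeomorph M' E} (he : e ∈ atlas E M')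
    {z : ℍ[ℝ] × E} (hz : z ∈ halfDomain (e.extend 𝓘(ℝ, E)).target) (X : ℍ[ℝ] × E) :
    mfderiv 𝓘(ℝ, ℍ[ℝ] × E) (prodModel E) ((e₁.prod e).extend (prodModel E)).symm z X =
      (X.1, chartInv e z.2 X.2) := by
  have h1 := (hasMFDerivAt_symm_of_mem_atlas_halfSpace he₁ hz.1).comp z
    (hasFDerivAt_fst (𝕜 := ℝ) (p := z)).hasMFDerivAt
  have h2 := ((mdifferentiable_of_mem_atlas (I := 𝓘(ℝ, E)) he).mdifferentiableAt_symm
    (mem_extend_target.1 hz.2)).hasMFDerivAt.comp z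
    (hasFDerivAt_snd (𝕜 := ℝ) (p := z)).hasMFDerivAt
  exact DFunLike.congr_fun (h1.prodMk h2).mfderiv X

theorem mfderiv_prod {e₁ : OpenPartialHomeomorph halfSpace ℍ[ℝ]}
    (he₁ : e₁ ∈ atlas ℍ[ℝ] halfSpace) {e : OpenPartialHomeomorph M' E} (he : e ∈ atlas E M')
    {p : halfSpace × M'} (hp : p.2 ∈ e.source) (X : ℍ[ℝ] × E) :
    mfderiv (prodModel E) 𝓘(ℝ, ℍ[ℝ] × E) ((e₁.prod e).extend (prodModel E)) p X =
      (X.1, chartDiff e p.2 X.2) := by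
  have h1 := (hasMFDerivAt_coe_halfSpace p.1).comp p
    (hasMFDerivAt_fst (I := 𝓘(ℝ, ℍ[ℝ])) (I' := 𝓘(ℝ, E)) p)
  have h2 := ((mdifferentiable_of_mem_atlas (I := 𝓘(ℝ, E)) he).mdifferentiableAt
    hp).hasMFDerivAt.comp p (hasMFDerivAt_snd (I := 𝓘(ℝ, ℍ[ℝ])) (I' := 𝓘(ℝ, E)) p)
  have h3 := ((ContinuousLinearMap.inl ℝ ℍ[ℝ] E).hasFDerivAt
    (x := (p.1 : ℍ[ℝ]))).hasMFDerivAt.comp p h1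
  have h4 := ((ContinuousLinearMap.inr ℝ ℍ[ℝ] E).hasFDerivAt (x := e p.2)).hasMFDerivAt.comp p h2
  -- The target is the normed space ℍ × E with its own model, not a product manifold; writing the
  -- chart as a sum of its two inclusions avoids comparing the two models.
  have h5 : ((e₁.prod e).extend (prodModel E) : halfSpace × M' → ℍ[ℝ] × E) =
      (fun p : halfSpace × M' => ContinuousLinearMap.inl ℝ ℍ[ℝ] E (p.1 : ℍ[ℝ])) +
        (fun p : halfSpace × M' => ContinuousLinearMap.inr ℝ ℍ[ℝ] E (e p.2)) := by
    funext p
    refine Prod.ext ?_ ?_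
    · simpa using coe_eq_of_mem_atlas_halfSpace he₁ p.1
    · simp
  rw [h5]
  refine (DFunLike.congr_fun (h3.add h4).mfderiv X).trans ?_
  refine Prod.ext ?_ ?_
  · exact add_zero _
  · exact zero_add _

end ProductCharts

/-! ### Locality of the coordinate notions -/

section Locality

variable {F : Type*} [NormedAddCommGroup F] [NormedSpace ℝ F]
  {g g' : F → F →L[ℝ] F →L[ℝ] ℝ} {A A' : F → F →L[ℝ] F} {y : F}

/-- The coordinate notions involve derivatives, so passing from the chart expressions to the model
needs equality of germs, not just of values. -/
theorem christoffel_congr (hg : g =ᶠ[nhds y] g') : christoffel g y = christoffel g' y := by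
  unfold christoffel christoffelLower
  rw [hg.fderiv_eq, hg.eq_of_nhds]

theorem nablaEnd_congr (hg : g =ᶠ[nhds y] g') (hA : A =ᶠ[nhds y] A') :
    nablaEnd g A y = nablaEnd g' A' y := by
  unfold nablaEnd
  rw [christoffel_congr hg, hA.fderiv_eq, hA.eq_of_nhds]

theorem curvature_congr (hg : g =ᶠ[nhds y] g') : curvature g y = curvature g' y := by
  have h : christoffel g =ᶠ[nhds y] christoffel g' :=
    hg.eventuallyEq_nhds.mono fun _ hz => christoffel_congr hz
  unfold curvature
  rw [h.fderiv_eq, h.eq_of_nhds]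

theorem scalarCurvature_congr [FiniteDimensional ℝ F] (hg : g =ᶠ[nhds y] g') :
    scalarCurvature g y = scalarCurvature g' y := by
  have h : ricci g y = ricci g' y := by
    refine LinearMap.ext₂ fun Y Z => ?_
    change LinearMap.trace ℝ F (((curvature g y).flip Y).flip Z).toLinearMap =
      LinearMap.trace ℝ F (((curvature g' y).flip Y).flip Z).toLinearMap
    rw [curvature_congr hg]
  unfold scalarCurvature
  rw [h, hg.eq_of_nhds]

theorem leeForm_congr (hg : g =ᶠ[nhds y] g') (hA : A =ᶠ[nhds y] A') (V : F) :
    leeForm g A y V = leeForm g' A' y V := by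
  unfold leeForm
  rw [nablaEnd_congr hg hA, hA.eq_of_nhds]

theorem nijenhuis_congr (hA : A =ᶠ[nhds y] A') (X Y : F) :
    nijenhuis A y X Y = nijenhuis A' y X Y := by
  unfold nijenhuis
  rw [hA.fderiv_eq, hA.eq_of_nhds]

end Locality

/-! ### The construction in product charts -/

section Construction

variable {E : Type*} [NormedAddCommGroup E] [NormedSpace ℝ E]
  {M' : Type*} [TopologicalSpace M'] [ChartedSpace E M']

/-- The product of a chart of the half-space and a chart of `M'`. -/
abbrev prodChart (e₁ : OpenPartialHomeomorph halfSpace ℍ[ℝ]) (e : OpenPartialHomeomorph M' E) :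
    OpenPartialHomeomorph (halfSpace × M') (ModelProd ℍ[ℝ] E) := e₁.prod e

/-- The three forms at a point. -/
def formTriple (αI αJ αK : FormField 𝓘(ℝ, E) M') (x : M') : Fin 3 → E →L[ℝ] ℝ :=
  ![αI x, αJ x, αK x]

theorem liftEnd_eq (ν : ℝ) (αI αJ αK : FormField 𝓘(ℝ, E) M') (a : ℍ[ℝ])
    (A' : EndField 𝓘(ℝ, E) M') (p : halfSpace × M') :
    liftEnd (connForm ν αI αJ αK) a A' p =
      modelEnd (modelForm ν (formTriple αI αJ αK p.2)) a (A' p.2) := rfl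

/-- The relation dt ∘ A_i = θ_i, up to the sign in the action on forms; this is the defining formula
for I dt, J dt, K dt. -/
theorem actForm_liftEnd_dt (ν : ℝ) (αI αJ αK : FormField 𝓘(ℝ, E) M') (i : Fin 3)
    (A' : EndField 𝓘(ℝ, E) M') (p : halfSpace × M') :
    actForm (liftEnd (connForm ν αI αJ αK) (quatUnit i) A') (dt E M') p =
      -thetaIm ν (formTriple αI αJ αK p.2) i := by
  rw [dt_eq]
  refine ContinuousLinearMap.ext fun X => ?_
  exact congrArg Neg.neg (theta_modelEnd ν (formTriple αI αJ αK p.2) i (A' p.2) X).1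

theorem actForm_liftEnd_pullForm (η : ∀ x : M', TangentSpace 𝓘(ℝ, E) x →L[ℝ] ℍ[ℝ]) (a : ℍ[ℝ])
    (A' : EndField 𝓘(ℝ, E) M') (β : FormField 𝓘(ℝ, E) M') :
    actForm (liftEnd η a A') (pullForm β) = pullForm (actForm A' β) := by
  rw [pullForm_eq, pullForm_eq]
  rfl

/-- The sign in A_i dt = -θ_i disappears in the tensor square. -/
theorem metric_eq (ν : ℝ) (g' : BilinField 𝓘(ℝ, E) M') (αI αJ αK : FormField 𝓘(ℝ, E) M')
    (I' J' K' : EndField 𝓘(ℝ, E) M') (p : halfSpace × M') :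
    metric ν g' (liftI ν αI αJ αK I') (liftJ ν αI αJ αK J') (liftK ν αI αJ αK K') p =
      modelMetric ν (p.1 : ℍ[ℝ]).re (formTriple αI αJ αK p.2) (g' p.2) := by
  have h0 := actForm_liftEnd_dt ν αI αJ αK 0 I' p
  have h1 := actForm_liftEnd_dt ν αI αJ αK 1 J' p
  have h2 := actForm_liftEnd_dt ν αI αJ αK 2 K' p
  have sq (ψ : ℍ[ℝ] × E →L[ℝ] ℝ) : (-ψ).smulRight (-ψ) = ψ.smulRight ψ := by
    refine ContinuousLinearMap.ext fun X => ContinuousLinearMap.ext fun Y => ?_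
    simp
  have s0 : tensorSq (actForm (liftI ν αI αJ αK I') (dt E M')) p =
      (thetaIm ν (formTriple αI αJ αK p.2) 0).smulRight
        (thetaIm ν (formTriple αI αJ αK p.2) 0) :=
    (congrArg (fun ψ : ℍ[ℝ] × E →L[ℝ] ℝ => ψ.smulRight ψ) h0).trans (sq _)
  have s1 : tensorSq (actForm (liftJ ν αI αJ αK J') (dt E M')) p =
      (thetaIm ν (formTriple αI αJ αK p.2) 1).smulRight
        (thetaIm ν (formTriple αI αJ αK p.2) 1) :=
    (congrArg (fun ψ : ℍ[ℝ] × E →L[ℝ] ℝ => ψ.smulRight ψ) h1).trans (sq _)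
  have s2 : tensorSq (actForm (liftK ν αI αJ αK K') (dt E M')) p =
      (thetaIm ν (formTriple αI αJ αK p.2) 2).smulRight
        (thetaIm ν (formTriple αI αJ αK p.2) 2) :=
    (congrArg (fun ψ : ℍ[ℝ] × E →L[ℝ] ℝ => ψ.smulRight ψ) h2).trans (sq _)
  have hm (ν t : ℝ) (β : Fin 3 → E →L[ℝ] ℝ) (b : E →L[ℝ] E →L[ℝ] ℝ) : modelMetric ν t β b =
      (-(1 / (ν * t ^ 2))) • ((thetaRe E).smulRight (thetaRe E) +
        ((thetaIm ν β 0).smulRight (thetaIm ν β 0) + (thetaIm ν β 1).smulRight (thetaIm ν β 1) +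
          (thetaIm ν β 2).smulRight (thetaIm ν β 2))) +
      (1 / t) • b.bilinearComp (ContinuousLinearMap.snd ℝ ℍ[ℝ] E)
        (ContinuousLinearMap.snd ℝ ℍ[ℝ] E) := by
    unfold modelMetric
    rw [Fin.sum_univ_three]
  rw [metric, s0, s1, s2, pullBilin_eq, dt_eq]
  exact (hm _ _ _ _).symm

variable [IsManifold 𝓘(ℝ, E) ∞ M']

section

variable {e₁ : OpenPartialHomeomorph halfSpace ℍ[ℝ]} (he₁ : e₁ ∈ atlas ℍ[ℝ] halfSpace)
  {e : OpenPartialHomeomorph M' E} (he : e ∈ atlas E M') {z : ℍ[ℝ] × E}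
  (hz : z ∈ halfDomain (e.extend 𝓘(ℝ, E)).target)
include he₁ he hz

theorem chartForm_prod_apply (ψ : FormField (prodModel E) (halfSpace × M')) (X : ℍ[ℝ] × E) :
    chartForm (prodChart e₁ e) ψ z X =
      (show ℍ[ℝ] × E →L[ℝ] ℝ from ψ (e₁.symm z.1, e.symm z.2)) (X.1, chartInv e z.2 X.2) :=
  congrArg (show ℍ[ℝ] × E →L[ℝ] ℝ from ψ (e₁.symm z.1, e.symm z.2))
    (mfderiv_prod_symm he₁ he hz X)

theorem chartBilin_prod_apply (b : BilinField (prodModel E) (halfSpace × M'))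
    (X Y : ℍ[ℝ] × E) :
    chartBilin (prodChart e₁ e) b z X Y =
      (show ℍ[ℝ] × E →L[ℝ] ℍ[ℝ] × E →L[ℝ] ℝ from b (e₁.symm z.1, e.symm z.2))
        (X.1, chartInv e z.2 X.2) (Y.1, chartInv e z.2 Y.2) :=
  congrArg₂ (fun V W =>
    (show ℍ[ℝ] × E →L[ℝ] ℍ[ℝ] × E →L[ℝ] ℝ from b (e₁.symm z.1, e.symm z.2)) V W)
    (mfderiv_prod_symm he₁ he hz X) (mfderiv_prod_symm he₁ he hz Y)

theorem chartEnd_prod_apply {A : EndField (prodModel E) (halfSpace × M')}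
    {B : ℍ[ℝ] × E →L[ℝ] ℍ[ℝ] × E} (hB : A (e₁.symm z.1, e.symm z.2) = B) (X : ℍ[ℝ] × E) :
    chartEnd (prodChart e₁ e) A z X = ((B (X.1, chartInv e z.2 X.2)).1,
      chartDiff e (e.symm z.2) (B (X.1, chartInv e z.2 X.2)).2) := by
  subst hB
  have hs : e.symm z.2 ∈ e.source := e.map_target (mem_extend_target.1 hz.2)
  exact (mfderiv_prod he₁ he (p := (e₁.symm z.1, e.symm z.2)) hs _).trans
    (congrArg (fun W : ℍ[ℝ] × E =>
      (((show ℍ[ℝ] × E →L[ℝ] ℍ[ℝ] × E from A (e₁.symm z.1, e.symm z.2)) W).1,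
        chartDiff e (e.symm z.2)
          ((show ℍ[ℝ] × E →L[ℝ] ℍ[ℝ] × E from A (e₁.symm z.1, e.symm z.2)) W).2))
      (mfderiv_prod_symm he₁ he hz X))

/-- The lift is natural: the product chart is the identity on the ℍ factor, so its effect is to
conjugate A' and pull back the α's by the chart of M'. -/
theorem chartEnd_liftEnd (ν : ℝ) (αI αJ αK : FormField 𝓘(ℝ, E) M') (a : ℍ[ℝ])
    (A' : EndField 𝓘(ℝ, E) M') :
    chartEnd (prodChart e₁ e) (liftEnd (connForm ν αI αJ αK) a A') z =
      modelEnd (modelForm ν fun i => ![chartForm e αI, chartForm e αJ, chartForm e αK] i z.2) a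
        (chartEnd e A' z.2) := by
  have hη (Y : E) : modelForm ν (fun i => ![chartForm e αI, chartForm e αJ, chartForm e αK] i z.2)
      Y = modelForm ν (formTriple αI αJ αK (e.symm z.2)) (chartInv e z.2 Y) := rfl
  have hA (Y : E) : chartEnd e A' z.2 Y = chartDiff e (e.symm z.2)
      ((show E →L[ℝ] E from A' (e.symm z.2)) (chartInv e z.2 Y)) := rfl
  refine ContinuousLinearMap.ext fun X => ?_
  rw [chartEnd_prod_apply he₁ he hz (liftEnd_eq ν αI αJ αK a A' _)]
  refine Prod.ext ?_ ?_
  · rw [modelEnd_fst, hη, hη, hA, chartInv_chartDiff he hz.2]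
    rfl
  · rfl

theorem chartBilin_metric (ν : ℝ) (g' : BilinField 𝓘(ℝ, E) M')
    (αI αJ αK : FormField 𝓘(ℝ, E) M') (I' J' K' : EndField 𝓘(ℝ, E) M') :
    chartBilin (prodChart e₁ e)
      (metric ν g' (liftI ν αI αJ αK I') (liftJ ν αI αJ αK J') (liftK ν αI αJ αK K')) z =
      modelMetricField ν (chartBilin e g') ![chartForm e αI, chartForm e αJ, chartForm e αK] z := by
  refine ContinuousLinearMap.ext fun X => ContinuousLinearMap.ext fun Y => ?_
  rw [chartBilin_prod_apply he₁ he hz, metric_eq, modelMetricField]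
  have hre : ((e₁.symm z.1 : halfSpace) : ℍ[ℝ]) = z.1 :=
    coe_symm_of_mem_atlas_halfSpace he₁ hz.1
  have hθ (i : Fin 3) (X : ℍ[ℝ] × E) : thetaIm ν (formTriple αI αJ αK (e.symm z.2)) i
      (X.1, chartInv e z.2 X.2) =
      thetaIm ν (fun i => ![chartForm e αI, chartForm e αJ, chartForm e αK] i z.2) i X := by
    fin_cases i <;> rfl
  refine (modelMetric_apply _ _ _ _ _ _).trans (Eq.trans ?_ (modelMetric_apply _ _ _ _ _ _).symm)
  simp only [hre, hθ]
  rfl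

end

end Construction

/-! ### The norm of the Lee form and the almost hyper-Hermitian structure -/

section Structure

/-- Identifies ν t ∂_t as the metric dual of the Lee form -dt/t; evaluating the latter on it gives
-ν. -/
theorem modelMetric_thetaVec {E : Type*} [NormedAddCommGroup E] [NormedSpace ℝ E] {ν t : ℝ}
    (hν : ν ≠ 0) (ht : t ≠ 0) (β : Fin 3 → E →L[ℝ] ℝ) (b : E →L[ℝ] E →L[ℝ] ℝ) :
    modelMetric ν t β b (thetaVec ν β (ν * t) 0 0) = -((1 / t) • thetaRe E) := by
  refine ContinuousLinearMap.ext fun Y => ?_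
  simp only [modelMetric_apply, thetaRe_thetaVec, thetaIm_thetaVec, thetaVec_snd, Pi.zero_apply,
    zero_mul, Finset.sum_const_zero, map_zero, zero_apply, neg_apply, smul_apply, smul_eq_mul]
  field_simp
  ring

variable {E : Type*} [NormedAddCommGroup E] [NormedSpace ℝ E]
  {M' : Type*} [TopologicalSpace M'] [ChartedSpace E M']

theorem normSqForm_log [FiniteDimensional ℝ E] (ν : ℝ) (hν : ν < 0) {g' : BilinField 𝓘(ℝ, E) M'}
    (hg' : IsRiemannianMetric g') (αI αJ αK : FormField 𝓘(ℝ, E) M')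
    (I' J' K' : EndField 𝓘(ℝ, E) M') (p : halfSpace × M') :
    normSqForm (metric ν g' (liftI ν αI αJ αK I') (liftJ ν αI αJ αK J') (liftK ν αI αJ αK K'))
      (-differential fun p => Real.log (p.1 : ℍ[ℝ]).re) p + ν = 0 := by
  have ht : 0 < (p.1 : ℍ[ℝ]).re := p.1.2
  have ht' := ht.ne'
  have hp : PosDefForm (modelMetric ν (p.1 : ℍ[ℝ]).re (formTriple αI αJ αK p.2) (g' p.2)) :=
    modelMetric_posDef (E := E) (hg'.pos p.2) hν ht _
  have hv := modelMetric_thetaVec hν.ne ht' (formTriple αI αJ αK p.2) (g' p.2)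
  have hi := hp.inverse_apply (thetaVec ν (formTriple αI αJ αK p.2) (ν * (p.1 : ℍ[ℝ]).re) 0 0)
  rw [hv] at hi
  have hφ : (-differential (E := E) (M' := M') fun p => Real.log (p.1 : ℍ[ℝ]).re) p =
      -((1 / (p.1 : ℍ[ℝ]).re) • thetaRe E) := by
    rw [differential_log_re]; rfl
  have key : (-((1 / (p.1 : ℍ[ℝ]).re) • thetaRe E))
      ((modelMetric ν (p.1 : ℍ[ℝ]).re (formTriple αI αJ αK p.2) (g' p.2)).inverse
        (-((1 / (p.1 : ℍ[ℝ]).re) • thetaRe E))) = -ν := by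
    rw [hi]
    simp only [neg_apply, smul_apply, thetaRe_thetaVec, smul_eq_mul]
    field_simp
  unfold normSqForm
  rw [hφ, metric_eq]
  refine (congrArg (· + ν) key).trans ?_
  exact neg_add_cancel ν

variable [IsManifold 𝓘(ℝ, E) ∞ M']

theorem isAlmostHyperHermitian_lift {g' : BilinField 𝓘(ℝ, E) M'}
    {I' J' K' : EndField 𝓘(ℝ, E) M'} (hM' : IsHyperKahler g' I' J' K')
    {αI αJ αK : FormField 𝓘(ℝ, E) M'}
    (hα : ∀ e ∈ atlas E M', HyperKahlerChart (e.extend 𝓘(ℝ, E)).target (chartBilin e g')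
      ![chartEnd e I', chartEnd e J', chartEnd e K']
      ![chartForm e αI, chartForm e αJ, chartForm e αK]) {ν : ℝ} (hν : ν < 0) :
    IsAlmostHyperHermitian
      (metric ν g' (liftI ν αI αJ αK I') (liftJ ν αI αJ αK J') (liftK ν αI αJ αK K'))
      (liftI ν αI αJ αK I') (liftJ ν αI αJ αK J') (liftK ν αI αJ αK K') := by
  have h := hM'.almostHyperHermitian
  have hsmooth (i : Fin 3) (A' : EndField 𝓘(ℝ, E) M')
      (hA : ∀ e ∈ atlas E M', ∀ z, modelEndField ν ![chartEnd e I', chartEnd e J', chartEnd e K']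
        ![chartForm e αI, chartForm e αJ, chartForm e αK] i z =
        modelEnd (modelForm ν fun i => ![chartForm e αI, chartForm e αJ, chartForm e αK] i z.2)
          (quatUnit i) (chartEnd e A' z.2)) :
      SmoothEnd (liftEnd (connForm ν αI αJ αK) (quatUnit i) A') := by
    rintro _ ⟨e₁, he₁, e, he, rfl⟩
    rw [extend_prod_target he₁]
    intro z hz
    refine ((hα e he).contDiffAt_modelEndField ν hz i).contDiffWithinAt.congr
      (fun w hw => ?_) ?_
    · exact (chartEnd_liftEnd he₁ he hw ν αI αJ αK _ A').trans (hA e he w).symm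
    · exact (chartEnd_liftEnd he₁ he hz ν αI αJ αK _ A').trans (hA e he z).symm
  have horth (i : Fin 3) (A' : EndField 𝓘(ℝ, E) M') (hA : IsOrthogonal g' A') :
      IsOrthogonal
        (metric ν g' (liftI ν αI αJ αK I') (liftJ ν αI αJ αK J') (liftK ν αI αJ αK K'))
        (liftEnd (connForm ν αI αJ αK) (quatUnit i) A') := by
    intro p X Y
    rw [metric_eq, liftEnd_eq]
    exact modelMetric_orth (E := E) (hA p.2) ν _ _ i X Y
  have hsq (i : Fin 3) (A' : EndField 𝓘(ℝ, E) M')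
      (hA : ∀ (x : M') (X : TangentSpace 𝓘(ℝ, E) x), A' x (A' x X) = -X)
      (p : halfSpace × M') (X : TangentSpace (prodModel E) p) :
      liftEnd (connForm ν αI αJ αK) (quatUnit i) A' p
        (liftEnd (connForm ν αI αJ αK) (quatUnit i) A' p X) = -X :=
    modelEnd_sq (E := E) (B := A' p.2) (hA p.2) ν (formTriple αI αJ αK p.2) i X
  refine ⟨⟨?_, ?_, ?_⟩, ⟨hsmooth 0 I' fun _ _ _ => rfl, hsmooth 1 J' fun _ _ _ => rfl,
    hsmooth 2 K' fun _ _ _ => rfl, hsq 0 I' h.hypercomplex.I_sq, hsq 1 J' h.hypercomplex.J_sq,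
    hsq 2 K' h.hypercomplex.K_sq, ?_⟩, horth 0 I' h.orth_I, horth 1 J' h.orth_J,
    horth 2 K' h.orth_K⟩
  · rintro _ ⟨e₁, he₁, e, he, rfl⟩
    rw [extend_prod_target he₁]
    intro z hz
    exact ((hα e he).contDiffAt_modelMetricField hν hz).contDiffWithinAt.congr
      (fun w hw => chartBilin_metric he₁ he hw ν g' αI αJ αK I' J' K')
      (chartBilin_metric he₁ he hz ν g' αI αJ αK I' J' K')
  · intro p X Y
    rw [metric_eq]
    exact modelMetric_symm (E := E) (h.metric.symm p.2) ν _ _ X Y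
  · intro p X hX
    rw [metric_eq]
    exact modelMetric_posDef (E := E) (h.metric.pos p.2) hν p.1.2 _ X hX
  · intro p X
    have h1 := modelEnd_mul (E := E) (hM'.triple p.2).AB ν (formTriple αI αJ αK p.2) 0
      (modelEnd (modelForm ν (formTriple αI αJ αK p.2)) (quatUnit 2) (K' p.2) X)
    exact h1.trans (hsq 2 K' h.hypercomplex.K_sq p X)

end Structure

end HHqK

end

/-! ### The main theorem -/

open HHqK in
theorem theorem6 {E : Type*} [NormedAddCommGroup E] [NormedSpace ℝ E] [FiniteDimensional ℝ E]
    {M' : Type*} [TopologicalSpace M'] [ChartedSpace E M'] [IsManifold 𝓘(ℝ, E) ∞ M']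
    (n : ℕ) (hn : 1 < n) (hdim : Module.finrank ℝ E = 4 * (n - 1))
    (g' : BilinField 𝓘(ℝ, E) M') (I' J' K' : EndField 𝓘(ℝ, E) M')
    (hM' : IsHyperKahler g' I' J' K')
    (αI αJ αK : FormField 𝓘(ℝ, E) M')
    (hαI : SmoothForm αI) (hαJ : SmoothForm αJ) (hαK : SmoothForm αK)
    (hdI : IsPrimitiveOfKahlerForm g' I' αI) (hdJ : IsPrimitiveOfKahlerForm g' J' αJ)
    (hdK : IsPrimitiveOfKahlerForm g' K' αK)
    (ν : ℝ) (hν : ν < 0)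
    (I J K : EndField (prodModel E) (halfSpace × M'))
    (hI : I = liftI ν αI αJ αK I') (hJ : J = liftJ ν αI αJ αK J')
    (hK : K = liftK ν αI αJ αK K')
    (g : BilinField (prodModel E) (halfSpace × M')) (hg : g = metric ν g' I J K)
    (φ : FormField (prodModel E) (halfSpace × M'))
    (hφ : φ = -differential fun p => Real.log (p.1 : ℍ[ℝ]).re) :
    (actForm I (dt E M') = -du E M' + ν • pullForm αI ∧
      actForm J (dt E M') = -dv E M' + ν • pullForm αJ ∧
      actForm K (dt E M') = -dw E M' + ν • pullForm αK) ∧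
    (∀ β : FormField 𝓘(ℝ, E) M',
      actForm I (pullForm β) = pullForm (actForm I' β) ∧
      actForm J (pullForm β) = pullForm (actForm J' β) ∧
      actForm K (pullForm β) = pullForm (actForm K' β)) ∧
    IsHyperHermitianQuaternionicKahler n g I J K ∧
    HasReducedScalarCurvature n g ν ∧
    (HasLeeForm g I φ ∧ HasLeeForm g J φ ∧ HasLeeForm g K φ) ∧
    (∀ p : halfSpace × M', normSqForm g φ p + ν = 0) := by
  subst hI hJ hK hg hφ
  have hα : ∀ e ∈ atlas E M', HyperKahlerChart (e.extend 𝓘(ℝ, E)).target (chartBilin e g')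
      ![chartEnd e I', chartEnd e J', chartEnd e K']
      ![chartForm e αI, chartForm e αJ, chartForm e αK] := fun e he =>
    hM'.hyperKahlerChart hαI hαJ hαK hdI hdJ hdK he
  -- The truncated subtraction in `hdim` is harmless because n > 1.
  have hfin : Module.finrank ℝ (ℍ[ℝ] × E) = 4 * n := by
    rw [Module.finrank_prod, Quaternion.finrank_eq_four, hdim]
    lia
  set I := liftI ν αI αJ αK I' with hI
  set J := liftJ ν αI αJ αK J' with hJ
  set K := liftK ν αI αJ αK K' with hK
  set g := metric ν g' I J K with hg
  have hmem {e : OpenPartialHomeomorph M' E} {z : ℍ[ℝ] × E}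
      (hz : z ∈ halfDomain (e.extend 𝓘(ℝ, E)).target) :
      ∀ᶠ w in nhds z, w ∈ halfDomain (e.extend 𝓘(ℝ, E)).target :=
    (isOpen_halfDomain e.isOpen_extend_target).mem_nhds hz
  have hgG {e₁ : OpenPartialHomeomorph halfSpace ℍ[ℝ]} (he₁ : e₁ ∈ atlas ℍ[ℝ] halfSpace)
      {e : OpenPartialHomeomorph M' E} (he : e ∈ atlas E M') {z : ℍ[ℝ] × E}
      (hz : z ∈ halfDomain (e.extend 𝓘(ℝ, E)).target) :
      chartBilin (prodChart e₁ e) g =ᶠ[nhds z] modelMetricField ν (chartBilin e g')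
        ![chartForm e αI, chartForm e αJ, chartForm e αK] :=
    (hmem hz).mono fun w hw => chartBilin_metric he₁ he hw ν g' αI αJ αK I' J' K'
  have hlift {e₁ : OpenPartialHomeomorph halfSpace ℍ[ℝ]} (he₁ : e₁ ∈ atlas ℍ[ℝ] halfSpace)
      {e : OpenPartialHomeomorph M' E} (he : e ∈ atlas E M') {z : ℍ[ℝ] × E}
      (hz : z ∈ halfDomain (e.extend 𝓘(ℝ, E)).target) (i : Fin 3) :
      chartEnd (prodChart e₁ e) (![I, J, K] i) =ᶠ[nhds z]
        modelEndField ν ![chartEnd e I', chartEnd e J', chartEnd e K']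
          ![chartForm e αI, chartForm e αJ, chartForm e αK] i :=
    (hmem hz).mono fun w hw => forall_fin_three_cyclic
      (p := fun i => chartEnd (prodChart e₁ e) (![I, J, K] i) w =
        modelEndField ν ![chartEnd e I', chartEnd e J', chartEnd e K']
          ![chartForm e αI, chartForm e αJ, chartForm e αK] i w) 0
      (chartEnd_liftEnd he₁ he hw ν αI αJ αK (quatUnit 0) I')
      (chartEnd_liftEnd he₁ he hw ν αI αJ αK (quatUnit 1) J')
      (chartEnd_liftEnd he₁ he hw ν αI αJ αK (quatUnit 2) K') i
  -- With d = 4n, d(d+8)/4 = 4n(n+2). Charts of the product atlas are products of charts, hence the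
  -- pattern in the `rintro`.
  have hscal : HasScalarCurvature g fun _ => ν * (4 * n * (n + 2)) := by
    rintro _ ⟨e₁, he₁, e, he, rfl⟩ z hz
    rw [extend_prod_target he₁] at hz
    refine (scalarCurvature_congr (hgG he₁ he hz)).trans ?_
    rw [(hα e he).scalarCurvature_modelMetricField hν hz, hfin]
    push_cast
    ring
  have hn0 : (4 * n * (n + 2) : ℝ) ≠ 0 := by positivity
  have hnij (i : Fin 3) : IsIntegrable (![I, J, K] i) := by
    rintro _ ⟨e₁, he₁, e, he, rfl⟩ z hz X Y
    rw [extend_prod_target he₁] at hz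
    exact (nijenhuis_congr (hlift he₁ he hz i) X Y).trans
      ((hα e he).nijenhuis_modelEndField hν hz i X Y)
  have hlee (i : Fin 3) :
      HasLeeForm g (![I, J, K] i) (-differential fun p => Real.log (p.1 : ℍ[ℝ]).re) := by
    rintro _ ⟨e₁, he₁, e, he, rfl⟩ z hz V
    rw [extend_prod_target he₁] at hz
    refine (leeForm_congr (hgG he₁ he hz) (hlift he₁ he hz i) V).trans ?_
    rw [(hα e he).leeForm_modelEndField hν hz]
    refine Eq.trans ?_ (chartForm_prod_apply he₁ he hz _ V).symm
    rw [differential_log_re]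
    change _ = -(1 / ((e₁.symm z.1 : halfSpace) : ℍ[ℝ]).re * V.1.re)
    rw [coe_symm_of_mem_atlas_halfSpace he₁ hz.1]
    rfl
  have hspan : SpanParallel g I J K := by
    rintro _ ⟨e₁, he₁, e, he, rfl⟩ z hz A hA X
    rw [extend_prod_target he₁] at hz
    have hS (i : Fin 3) : modelEndField ν ![chartEnd e I', chartEnd e J', chartEnd e K']
        ![chartForm e αI, chartForm e αJ, chartForm e αK] i z ∈
        Submodule.span ℝ ({chartEnd (prodChart e₁ e) I z, chartEnd (prodChart e₁ e) J z,
          chartEnd (prodChart e₁ e) K z} : Set (ℍ[ℝ] × E →L[ℝ] ℍ[ℝ] × E)) := by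
      rw [← (hlift he₁ he hz i).eq_of_nhds]
      refine Submodule.subset_span ?_
      fin_cases i <;> simp
    have key (i : Fin 3) : nablaEnd (chartBilin (prodChart e₁ e) g)
        (chartEnd (prodChart e₁ e) (![I, J, K] i)) z X ∈
        Submodule.span ℝ ({chartEnd (prodChart e₁ e) I z, chartEnd (prodChart e₁ e) J z,
          chartEnd (prodChart e₁ e) K z} : Set (ℍ[ℝ] × E →L[ℝ] ℍ[ℝ] × E)) := by
      rw [nablaEnd_congr (hgG he₁ he hz) (hlift he₁ he hz i),
        (hα e he).nablaEnd_modelEndField hν hz]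
      exact Submodule.sub_mem _ (Submodule.smul_mem _ _ (hS _)) (Submodule.smul_mem _ _ (hS _))
    rcases hA with rfl | rfl | rfl
    · exact key 0
    · exact key 1
    · exact key 2
  refine ⟨⟨?_, ?_, ?_⟩, fun β => ⟨actForm_liftEnd_pullForm _ _ _ _,
    actForm_liftEnd_pullForm _ _ _ _, actForm_liftEnd_pullForm _ _ _ _⟩,
    ⟨hn, hfin, isAlmostHyperHermitian_lift hM' hα hν, hnij 0, hnij 1, hnij 2, hspan, ?_⟩,
    ⟨_, hscal, by field_simp⟩, ⟨hlee 0, hlee 1, hlee 2⟩,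
    normSqForm_log ν hν hM'.almostHyperHermitian.metric αI αJ αK I' J' K'⟩
  · funext p
    refine (actForm_liftEnd_dt ν αI αJ αK 0 I' p).trans ?_
    rw [du_eq, pullForm_eq]
    exact (neg_sub _ _).trans (sub_eq_neg_add _ _)
  · funext p
    refine (actForm_liftEnd_dt ν αI αJ αK 1 J' p).trans ?_
    rw [dv_eq, pullForm_eq]
    exact (neg_sub _ _).trans (sub_eq_neg_add _ _)
  · funext p
    refine (actForm_liftEnd_dt ν αI αJ αK 2 K' p).trans ?_
    rw [dw_eq, pullForm_eq]
    exact (neg_sub _ _).trans (sub_eq_neg_add _ _)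
  · intro e he y hy
    rw [hscal e he y hy]
    exact mul_ne_zero hν.ne hn0
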